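/- Let $g,\gamma,\sigma,c\in\mathbb R$ (gravity, constant vorticity, surface tension, velocity). Let $H$ be the Hilbert transform on $\mathbb R$ (Fourier symbol $-i\,\mathrm{sgn}\,\xi$), $|D|=\partial_\alpha H=H\partial_\alpha$ (which annihilates constants), and $\mathbf P=\frac12(I-iH)$ the projection onto negative frequencies. Let $u\in H^2(\mathbb R)$ be real-valued, $u\neq0$, such that $J=(1+|D|u)^2+u_\alpha^2$ has no zeros, and suppose that $u$ solves the Babenko equation $$(g+c\gamma-c^2|D|)u-\sigma\Big(\frac{u_\alpha}{J^{1/2}}\Big)_\alpha+\sigma|D|\Big(\frac{1+|D|u}{J^{1/2}}\Big)=-\frac{\gamma^2}{2}u^2-g\,u|D|u-\frac g2|D|u^2+\frac{\gamma^2}{2}u|D|u^2-\frac{\gamma^2}{2}u^2|D|u-\frac{\gamma^2}{6}|D|u^3 .$$ Assume also that $z\mapsto z+\frac1\pi\int_{\mathbb R}\frac{u(s)}{z-s}\,ds$, the holomorphic extension of $\alpha+Hu+iu$ to the lower half-plane, has non-vanishing derivative on $\{\operatorname{Im} z<0\}$. Then $$W(t,\alpha)=Hu+iu,\qquad Q(t,\alpha)=-cHu-\frac\gamma2H(u^2)-i\Big(cu+\frac\gamma2u^2\Big),$$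 with $Hu$, $u$, $H(u^2)$, $u^2$ evaluated at $\alpha+ct$, is a solitary wave solution with velocity $c$ of the water wave system $$W_t+(W_\alpha+1)\underline F+\frac{i\gamma}{2}W=0,$$ $$Q_t-igW+\underline F Q_\alpha+i\gamma Q+\mathbf P\Big[\frac{|Q_\alpha|^2}{J}\Big]-\tfrac{i\gamma}{2}T_1-2\sigma\mathbf P\operatorname{Im}\Big[\frac{W_{\alpha\alpha}}{J^{1/2}(1+W_\alpha)}\Big]=0,$$ where $J=|1+W_\alpha|^2$, $\underline F=\mathbf P\big[\frac{Q_\alpha-\bar Q_\alpha}{J}\big]-\frac{i\gamma}2\mathbf P\big[\frac{W}{1+\bar W_\alpha}+\frac{\bar W}{1+W_\alpha}\big]$ and $T_1=\mathbf P\big[\frac{W\bar Q_\alpha}{1+\bar W_\alpha}-\frac{\bar WQ_\alpha}{1+W_\alpha}\big]$. That is: $W,Q$ are $C^1$ in $(t,\alpha)$; at each time $t$ they lie in $H^2(\mathbb R)$, satisfy $\mathbf PW=W$ and $\mathbf PQ=Q$, $J$ has no zeros, and the two equations hold for almost every $\alpha$; and $(W,Q)$ is a nonzero function of $\alpha+ct$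 alone which tends to $0$ as $\alpha+ct\to\pm\infty$. -/

import Mathlib

open MeasureTheory Filter Topology FourierTransform

noncomputable section

/-! ## The Hilbert transform on the line -/

/-- The function `-i sgn(ξ) g(ξ)` is square integrable when `g` is. -/
theorem memLp_hilbertSymbol_mul (g : Lp ℂ 2 (volume : Measure ℝ)) :
    MemLp (fun ξ : ℝ => -Complex.I * (Real.sign ξ : ℂ) * g ξ) 2 volume := by
  have hs : Measurable (fun ξ : ℝ => (Real.sign ξ : ℂ)) := by
    refine Complex.measurable_ofReal.comp ?_
    unfold Real.sign
    exact Measurable.ite measurableSet_Iio measurable_const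
      (Measurable.ite measurableSet_Ioi measurable_const measurable_const)
  refine MemLp.of_le (Lp.memLp g)
    ((measurable_const.mul hs).aestronglyMeasurable.mul (Lp.aestronglyMeasurable g)) ?_
  refine Filter.Eventually.of_forall fun ξ => ?_
  have h1 : ‖(Real.sign ξ : ℂ)‖ ≤ 1 := by
    rcases Real.sign_apply_eq ξ with h | h | h <;> simp [h]
  calc ‖-Complex.I * (Real.sign ξ : ℂ) * g ξ‖ = ‖(Real.sign ξ : ℂ)‖ * ‖g ξ‖ := by simp
    _ ≤ 1 * ‖g ξ‖ := by gcongr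
    _ = ‖g ξ‖ := one_mul _

/-- The Hilbert transform on `L²(ℝ)`, the Fourier multiplier with symbol `-i sgn(ξ)`. -/
def hilbertL2 (f : Lp ℂ 2 (volume : Measure ℝ)) : Lp ℂ 2 (volume : Measure ℝ) :=
  𝓕⁻ ((memLp_hilbertSymbol_mul (𝓕 f)).toLp _)

open Classical in
/-- The continuous representative of `f` (modulo null sets) if there is one, and `f` otherwise. -/
def contRep (f : ℝ → ℂ) : ℝ → ℂ :=
  if h : ∃ g : ℝ → ℂ, Continuous g ∧ g =ᵐ[volume] f then h.choose else f

open Classical in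
/-- The Hilbert transform `H f` of a square integrable function `f : ℝ → ℂ`, as a function:
the continuous representative of the `L²` class is taken whenever it exists. -/
def hilbert (f : ℝ → ℂ) : ℝ → ℂ :=
  if h : MemLp f 2 (volume : Measure ℝ) then contRep (hilbertL2 (h.toLp f)) else 0

/-- The Hilbert transform of a real-valued function, which is real-valued. -/
def hilbertReal (f : ℝ → ℝ) : ℝ → ℝ :=
  fun α => (hilbert (fun β => (f β : ℂ)) α).re

/-- The projection onto negative frequencies, `P = (I - iH) / 2`. -/
def projNeg (f : ℝ → ℂ) : ℝ → ℂ :=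
  fun α => (f α - Complex.I * hilbert f α) / 2

/-- The operator `|D| = ∂H = H∂` (Fourier symbol `|ξ|`) on real-valued functions.  In the form
`H∂` it also applies to a constant plus an `H¹` function, and it annihilates constants. -/
def absD (f : ℝ → ℝ) : ℝ → ℝ :=
  hilbertReal (deriv f)

/-! ## The Sobolev space `H²(ℝ)` -/

/-- `f` is (the continuous representative of) an element of `H²(ℝ)`. -/
def MemH2 (f : ℝ → ℂ) : Prop :=
  Continuous f ∧ ∃ h : MemLp f 2 (volume : Measure ℝ),
    TemperedDistribution.MemSobolev 2 2
      (Lp.toTemperedDistribution (h.toLp f) : TemperedDistribution ℝ ℂ)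

/-! ## The Babenko equation -/

/-- `J = (1 + |D|u)² + (u_α)²`. -/
def babenkoJ (u : ℝ → ℝ) (α : ℝ) : ℝ :=
  (1 + absD u α) ^ 2 + deriv u α ^ 2

/-- `u ∈ H²(ℝ)` is a real-valued solution of the Babenko equation with gravity `g`, vorticity `γ`,
surface tension `σ` and velocity `c`.  The equation is an equality of `L²` functions; that `J` has
no zeros gives a meaning to the division by `J^{1/2}`. -/
structure IsBabenkoSolution (g γ σ c : ℝ) (u : ℝ → ℝ) : Prop where
  memH2 : MemH2 (fun α => (u α : ℂ))
  jacobian_ne_zero : ∀ α, babenkoJ u α ≠ 0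
  equation : ∀ᵐ α : ℝ,
    (g + c * γ) * u α - c ^ 2 * absD u α
        - σ * deriv (fun β => deriv u β / √(babenkoJ u β)) α
        + σ * absD (fun β => (1 + absD u β) / √(babenkoJ u β)) α
      = - γ ^ 2 / 2 * u α ^ 2 - g * u α * absD u α - g / 2 * absD (fun β => u β ^ 2) α
        + γ ^ 2 / 2 * u α * absD (fun β => u β ^ 2) α - γ ^ 2 / 2 * u α ^ 2 * absD u α
        - γ ^ 2 / 6 * absD (fun β => u β ^ 3) α

/-- The holomorphic extension of `H u + i u` to the lower half-plane `Im z < 0`. -/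
def lowerExtension (u : ℝ → ℝ) (z : ℂ) : ℂ :=
  (1 / Real.pi : ℂ) * ∫ s : ℝ, (u s : ℂ) / (z - s)

/-- The holomorphic map `z ↦ z + W(z)` of the lower half-plane into the plane, where `W` extends
`H u + i u`, has no critical point: `1 + W_α` has no zero in the lower half-plane. -/
def IsConformalProfile (u : ℝ → ℝ) : Prop :=
  ∀ z : ℂ, z.im < 0 → deriv (fun w => w + lowerExtension u w) z ≠ 0

/-! ## The water wave system in holomorphic coordinates

In this section `W` and `Q` are the traces on the real line at a fixed time. -/

/-- `J = |1 + W_α|²`. -/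
def waveJ (W : ℝ → ℂ) (α : ℝ) : ℝ :=
  ‖1 + deriv W α‖ ^ 2

/-- `F = P[(Q_α - conj Q_α) / J]`. -/
def waveF (W Q : ℝ → ℂ) : ℝ → ℂ :=
  projNeg (fun α => (deriv Q α - star (deriv Q α)) / (waveJ W α : ℂ))

/-- `F₁ = P[W / (1 + conj W_α) + conj W / (1 + W_α)]`. -/
def waveF1 (W : ℝ → ℂ) : ℝ → ℂ :=
  projNeg (fun α => W α / (1 + star (deriv W α)) + star (W α) / (1 + deriv W α))

/-- `F - i (γ/2) F₁`. -/
def waveFUnderline (γ : ℝ) (W Q : ℝ → ℂ) (α : ℝ) : ℂ :=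
  waveF W Q α - Complex.I * (γ / 2) * waveF1 W α

/-- `T₁ = P[W conj(Q_α) / (1 + conj W_α) - conj W Q_α / (1 + W_α)]`. -/
def waveT1 (W Q : ℝ → ℂ) : ℝ → ℂ :=
  projNeg (fun α => W α * star (deriv Q α) / (1 + star (deriv W α))
    - star (W α) * deriv Q α / (1 + deriv W α))

/-- `P[|Q_α|² / J]`. -/
def waveKinetic (W Q : ℝ → ℂ) : ℝ → ℂ :=
  projNeg (fun α => ((‖deriv Q α‖ ^ 2 / waveJ W α : ℝ) : ℂ))

/-- `P Im[W_αα / (J^{1/2} (1 + W_α))]`. -/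
def waveCapillary (W : ℝ → ℂ) : ℝ → ℂ :=
  projNeg (fun α =>
    (((deriv (deriv W) α / ((√(waveJ W α) : ℂ) * (1 + deriv W α))).im : ℝ) : ℂ))

/-- `(W, Q)`, with `W t α` and `Q t α` for time `t` and spatial variable `α`, solves the water wave
system with gravity `g`, constant vorticity `γ` and surface tension `σ`: at each time `W` and `Q`
are `H²` traces of holomorphic functions in the lower half-plane (only negative frequencies), `J`
has no zeros, and the two evolution equations hold. -/
structure IsWaterWaveSolution (g γ σ : ℝ) (W Q : ℝ → ℝ → ℂ) : Prop where
  contDiff_W : ContDiff ℝ 1 (fun p : ℝ × ℝ => W p.1 p.2)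
  contDiff_Q : ContDiff ℝ 1 (fun p : ℝ × ℝ => Q p.1 p.2)
  memH2_W : ∀ t, MemH2 (W t)
  memH2_Q : ∀ t, MemH2 (Q t)
  holomorphic_W : ∀ t, projNeg (W t) = W t
  holomorphic_Q : ∀ t, projNeg (Q t) = Q t
  jacobian_ne_zero : ∀ t α, waveJ (W t) α ≠ 0
  equation_W : ∀ t, ∀ᵐ α : ℝ,
    deriv (fun s => W s α) t + (deriv (W t) α + 1) * waveFUnderline γ (W t) (Q t) α
      + Complex.I * (γ / 2) * W t α = 0
  equation_Q : ∀ t, ∀ᵐ α : ℝ,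
    deriv (fun s => Q s α) t - Complex.I * g * W t α
      + waveFUnderline γ (W t) (Q t) α * deriv (Q t) α + Complex.I * γ * Q t α
      + waveKinetic (W t) (Q t) α - Complex.I * (γ / 2) * waveT1 (W t) (Q t) α
      - 2 * σ * waveCapillary (W t) α = 0

/-- `(W, Q)` is a solitary wave with velocity `c`: a nontrivial solution of the form
`(w(α + ct), q(α + ct))` whose profile `(w, q)` vanishes at `±∞`. -/
def IsSolitaryWave (g γ σ c : ℝ) (W Q : ℝ → ℝ → ℂ) : Prop :=
  IsWaterWaveSolution g γ σ W Q ∧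
    ∃ w q : ℝ → ℂ, w ≠ 0 ∧
      (∀ t α, W t α = w (α + c * t)) ∧ (∀ t α, Q t α = q (α + c * t)) ∧
      Tendsto w (cocompact ℝ) (𝓝 0) ∧ Tendsto q (cocompact ℝ) (𝓝 0)

end

open scoped SchwartzMap ContDiff ENNReal ComplexConjugate

/-! ### The Fourier transform on L² as a relation between functions. -/

noncomputable section

/-! Write w = Hu + iu, A = 1 + w', R = w'/A, and q for the profile of Q; along a travelling wave the
time derivative is c times the space derivative. The argument takes place in the Hardy space of L²
functions with nonpositive frequencies. An L² product of two members is a member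
(`HasNegSpectrum.mul`), a real or purely imaginary member vanishes, and P is the identity on members
and kills their conjugates (`projNeg_ae_eq_of_add`). So every projection in the system can be
computed once its argument is split as a member plus the conjugate of a member.

Since Im q = -(cu + γu²/2), differentiation shows that S = q' + (c + γu)A is real. With this
relation the function projected in the velocity term is V - V̄, where V = -cR - (iγ/2) w/A. If R is
in the Hardy space then so is V = -cR - (iγ/2)(w - wR). Hence the velocity term is V, and the
kinematic equation becomes algebra. The functions projected in the dynamic equation add up to a real
function. Granted Bernoulli's law S² = |A|²(c² - 2gu + 2σκ), with κ the curvature of the surface,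
that function is -(D + D̄), where D collects the remaining terms of the equation. D is in the Hardy
space, so the projection is -D.

Bernoulli's law comes from the Babenko equation (`bernoulli_law`). Put B = (c² - 2gu + 2σκ)A - 2(c +
γu)q̄' - (c + γu)²Ā. By Frenet's formulas the Babenko equation says exactly that Re PB = 0. Then PB
is imaginary, hence zero, and B̄ is in the Hardy space. Therefore AB̄ - q'² is too. But it equals
|A|²(c² - 2gu + 2σκ) - S², which is real, so it vanishes.

The analytic input is that R is in the Hardy space (`hasNegSpectrum_div_one_add`). The extension of
A has no zero inside the half-plane, by the conformality assumption, nor on the line, where |A|² =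
J. It tends to 1 at infinity, so by compactness it is bounded away from zero. Thus R extends to a
bounded holomorphic function, and Cauchy's theorem gives its spectrum. -/

/-- `F` is the Fourier transform of `f`, both being square integrable. -/
def IsFT (f F : ℝ → ℂ) : Prop :=
  ∃ (hf : MemLp f 2 (volume : Measure ℝ)) (hF : MemLp F 2 (volume : Measure ℝ)),
    𝓕 (hf.toLp f) = hF.toLp F

namespace IsFT

variable {f g F G : ℝ → ℂ}

theorem memLp (h : IsFT f F) : MemLp f 2 volume := h.1

theorem memLp_ft (h : IsFT f F) : MemLp F 2 volume := h.2.1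

theorem congr (h : IsFT f F) (hf : f =ᵐ[volume] g) (hF : F =ᵐ[volume] G) : IsFT g G := by
  obtain ⟨h1, h2, h3⟩ := h
  refine ⟨h1.ae_eq hf, h2.ae_eq hF, ?_⟩
  rw [← MemLp.toLp_congr h1 (h1.ae_eq hf) hf, h3, MemLp.toLp_congr h2 (h2.ae_eq hF) hF]

theorem ae_eq_right (h : IsFT f F) (h' : IsFT f G) : F =ᵐ[volume] G := by
  obtain ⟨h1, h2, h3⟩ := h
  obtain ⟨h1', h2', h3'⟩ := h'
  exact (MemLp.toLp_eq_toLp_iff h2 h2').1 (h3.symm.trans h3')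

theorem ae_eq_left (h : IsFT f F) (h' : IsFT g F) : f =ᵐ[volume] g := by
  obtain ⟨h1, h2, h3⟩ := h
  obtain ⟨h1', h2', h3'⟩ := h'
  refine (MemLp.toLp_eq_toLp_iff h1 h1').1 ?_
  exact (Lp.fourierTransformₗᵢ ℝ ℂ).injective (h3.trans h3'.symm)

theorem add (h : IsFT f F) (h' : IsFT g G) :
    IsFT (fun x => f x + g x) (fun x => F x + G x) := by
  obtain ⟨h1, h2, h3⟩ := h
  obtain ⟨h1', h2', h3'⟩ := h'
  refine ⟨h1.add h1', h2.add h2', ?_⟩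
  have e1 : (h1.add h1').toLp (f + g) = h1.toLp f + h1'.toLp g := MemLp.toLp_add _ _
  have e2 : (h2.add h2').toLp (F + G) = h2.toLp F + h2'.toLp G := MemLp.toLp_add _ _
  exact (congrArg _ e1).trans (((Lp.fourierTransformₗᵢ ℝ ℂ).map_add _ _).trans
    ((congrArg₂ _ h3 h3').trans e2.symm))

theorem const_mul (h : IsFT f F) (a : ℂ) : IsFT (fun x => a * f x) (fun x => a * F x) := by
  obtain ⟨h1, h2, h3⟩ := h
  refine ⟨h1.const_mul a, h2.const_mul a, ?_⟩
  have e1 : (h1.const_mul a).toLp (fun x => a * f x) = a • h1.toLp f :=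
    MemLp.toLp_const_smul a h1
  have e2 : (h2.const_mul a).toLp (fun x => a * F x) = a • h2.toLp F :=
    MemLp.toLp_const_smul a h2
  exact (congrArg _ e1).trans (((Lp.fourierTransformₗᵢ ℝ ℂ).map_smul _ _).trans
    ((congrArg _ h3).trans e2.symm))

theorem neg (h : IsFT f F) : IsFT (fun x => -f x) (fun x => -F x) := by
  simpa using h.const_mul (-1)

theorem sub (h : IsFT f F) (h' : IsFT g G) :
    IsFT (fun x => f x - g x) (fun x => F x - G x) := by
  simpa [sub_eq_add_neg] using h.add h'.neg

/-- Plancherel's theorem. -/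
theorem integral_star_mul (h : IsFT f F) (h' : IsFT g G) :
    ∫ x, star (f x) * g x = ∫ x, star (F x) * G x := by
  obtain ⟨h1, h2, h3⟩ := h
  obtain ⟨h1', h2', h3'⟩ := h'
  have key := Lp.inner_fourier_eq (h1.toLp f) (h1'.toLp g)
  rw [h3, h3', L2.inner_def, L2.inner_def] at key
  have e : ∀ {a b : ℝ → ℂ} (ha : MemLp a 2 volume) (hb : MemLp b 2 volume),
      ∫ x, inner ℂ (ha.toLp a x) (hb.toLp b x) = ∫ x, star (a x) * b x := by
    intro a b ha hb
    refine integral_congr_ae ?_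
    filter_upwards [ha.coeFn_toLp, hb.coeFn_toLp] with x hx hy
    rw [hx, hy, RCLike.inner_apply, mul_comm]
    rfl
  rw [e, e] at key
  exact key.symm

/-- The L² transform is the restriction of the distributional one, which is defined by this duality.
Later transforms are identified by testing against it. -/
theorem integral_schwartz_mul (h : IsFT f F) (ψ : 𝓢(ℝ, ℂ)) :
    ∫ x, ψ x * F x = ∫ x, (𝓕 ψ) x * f x := by
  obtain ⟨h1, h2, h3⟩ := h
  have key := congrArg (fun T : 𝓢'(ℝ, ℂ) => T ψ) (Lp.fourier_toTemperedDistribution_eq (h1.toLp f))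
  simp only [TemperedDistribution.fourier_apply, Lp.toTemperedDistribution_apply, h3] at key
  have e1 : ∫ x, (𝓕 ψ) x • h1.toLp f x = ∫ x, (𝓕 ψ) x * f x := by
    refine integral_congr_ae ?_
    filter_upwards [h1.coeFn_toLp] with x hx
    rw [hx, smul_eq_mul]
  have e2 : ∫ x, ψ x • h2.toLp F x = ∫ x, ψ x * F x := by
    refine integral_congr_ae ?_
    filter_upwards [h2.coeFn_toLp] with x hx
    rw [hx, smul_eq_mul]
  rw [← e1, ← e2, key]

theorem integral_fourier_mul (h : IsFT f F) {φ : ℝ → ℂ} (hφ : ContDiff ℝ ∞ φ)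
    (hc : HasCompactSupport φ) : ∫ x, φ x * F x = ∫ x, 𝓕 φ x * f x :=
  h.integral_schwartz_mul (hc.toSchwartzMap hφ)

theorem exists_of_memLp (hf : MemLp f 2 volume) : ∃ F, IsFT f F :=
  ⟨_, hf, Lp.memLp (𝓕 (hf.toLp f)), (Lp.toLp_coeFn _ _).symm⟩

theorem exists_of_memLp_ft (hF : MemLp F 2 volume) : ∃ f, IsFT f F := by
  refine ⟨(𝓕⁻ (hF.toLp F) : Lp ℂ 2 (volume : Measure ℝ)), Lp.memLp _, hF, ?_⟩
  rw [Lp.toLp_coeFn]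
  exact (Lp.fourierTransformₗᵢ ℝ ℂ).apply_symm_apply _

/-- A square integrable function is determined by its pairing with Fourier transforms of test
functions. -/
theorem of_forall_integral (hf : MemLp f 2 volume) (hF : LocallyIntegrable F volume)
    (H : ∀ φ : ℝ → ℝ, ContDiff ℝ ∞ φ → HasCompactSupport φ →
      ∫ x, (φ x : ℂ) * F x = ∫ x, 𝓕 (fun y => (φ y : ℂ)) x * f x) : IsFT f F := by
  obtain ⟨F', hF'⟩ := exists_of_memLp hf
  refine hF'.congr (ae_eq_refl _) ?_
  refine ae_eq_of_integral_contDiff_smul_eq (hF'.memLp_ft.locallyIntegrable (by norm_num)) hF ?_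
  intro φ hφ hc
  have h1 : ContDiff ℝ ∞ (fun y => (φ y : ℂ)) := Complex.ofRealCLM.contDiff.comp hφ
  have h2 : HasCompactSupport (fun y => (φ y : ℂ)) := hc.comp_left (g := Complex.ofReal) rfl
  simpa using (hF'.integral_fourier_mul h1 h2).trans (H φ hφ hc).symm

/-- On integrable functions the Fourier transform is given by the integral. -/
theorem of_integrable (hf : MemLp f 2 volume) (hf1 : Integrable f) : IsFT f (𝓕 f) := by
  have hc : Continuous (𝓕 f) :=
    VectorFourier.fourierIntegral_continuous Real.continuous_fourierChar
      (by exact continuous_inner) hf1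
  refine of_forall_integral hf hc.locallyIntegrable ?_
  intro φ hφ hc
  have h1 : Integrable (fun y => (φ y : ℂ)) :=
    ((Complex.continuous_ofReal.comp hφ.continuous)).integrable_of_hasCompactSupport
      (hc.comp_left (g := Complex.ofReal) rfl)
  have key := VectorFourier.integral_fourierIntegral_smul_eq_flip (L := innerₗ ℝ)
    Real.continuous_fourierChar (by exact continuous_inner) h1 hf1
  rw [flip_innerₗ] at key
  exact key.symm

/-- The square of the Fourier transform is the reflection. -/
theorem reflect (h : IsFT f F) : IsFT F (fun x => f (-x)) := by
  have hneg : MemLp (fun x => f (-x)) 2 volume :=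
    h.memLp.comp_measurePreserving (Measure.measurePreserving_neg volume)
  refine of_forall_integral h.memLp_ft (hneg.locallyIntegrable (by norm_num)) ?_
  intro φ hφ hc
  have h1 : ContDiff ℝ ∞ (fun y => (φ y : ℂ)) := Complex.ofRealCLM.contDiff.comp hφ
  have h2 : HasCompactSupport (fun y => (φ y : ℂ)) := hc.comp_left (g := Complex.ofReal) rfl
  have key := h.integral_schwartz_mul (𝓕 (h2.toSchwartzMap h1))
  rw [← integral_neg_eq_self (fun x => (φ x : ℂ) * f (-x))]
  refine Eq.trans ?_ key.symm
  refine integral_congr_ae (Eventually.of_forall fun x => ?_)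
  have e : (𝓕 (𝓕 (h2.toSchwartzMap h1))) x = (φ (-x) : ℂ) := by
    have := congrArg (fun ψ : 𝓢(ℝ, ℂ) => ψ (-x)) (fourierInv_fourier_eq (F := 𝓢(ℝ, ℂ))
      (h2.toSchwartzMap h1))
    simp only [SchwartzMap.fourierInv_coe, Real.fourierInv_eq_fourier_neg, neg_neg] at this
    rw [SchwartzMap.fourier_coe, this]
    rfl
  simp only [e, neg_neg]

theorem fourierInv_of_integrable (hF : MemLp F 2 volume) (hF1 : Integrable F) :
    IsFT (𝓕⁻ F) F := by
  obtain ⟨f, hf⟩ := exists_of_memLp_ft hF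
  have h := hf.reflect.ae_eq_right (of_integrable hF hF1)
  refine hf.congr ?_ (ae_eq_refl _)
  have := (Measure.measurePreserving_neg (volume : Measure ℝ)).quasiMeasurePreserving.ae_eq h
  filter_upwards [this] with x hx
  simpa [Real.fourierInv_eq_fourier_neg] using hx

/-- Complex conjugation. -/
theorem star (h : IsFT f F) : IsFT (fun x => star (f x)) (fun ξ => star (F (-ξ))) := by
  have hneg : MemLp (fun x => F (-x)) 2 volume :=
    h.memLp_ft.comp_measurePreserving (Measure.measurePreserving_neg volume)
  refine of_forall_integral h.memLp.star (hneg.star.locallyIntegrable (by norm_num)) ?_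
  intro φ hφ hc
  have h1 : ContDiff ℝ ∞ (fun y => (φ (-y) : ℂ)) :=
    Complex.ofRealCLM.contDiff.comp (hφ.comp contDiff_neg)
  have h2 : HasCompactSupport (fun y => (φ (-y) : ℂ)) :=
    (hc.comp_homeomorph (Homeomorph.neg ℝ)).comp_left (g := Complex.ofReal) rfl
  have key := congrArg (starRingEnd ℂ) (h.integral_fourier_mul h1 h2)
  rw [← integral_conj, ← integral_conj] at key
  rw [← integral_neg_eq_self (fun x => (φ x : ℂ) * _)]
  refine Eq.trans ?_ (key.trans ?_)
  · refine integral_congr_ae (Eventually.of_forall fun x => ?_)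
    simp
  · refine integral_congr_ae (Eventually.of_forall fun x => ?_)
    have e : (starRingEnd ℂ) (𝓕 (fun y => (φ (-y) : ℂ)) x) = 𝓕 (fun y => (φ y : ℂ)) x := by
      rw [Real.fourier_real_eq_integral_exp_smul, Real.fourier_real_eq_integral_exp_smul,
        ← integral_conj, ← integral_neg_eq_self]
      refine integral_congr_ae (Eventually.of_forall fun y => ?_)
      simp [← Complex.exp_conj, Complex.conj_ofNat]
    simp [e]

/-- Translation becomes multiplication by a character. -/
theorem translate (h : IsFT f F) (a : ℝ) :
    IsFT (fun x => f (x + a)) (fun ξ : ℝ => Complex.exp (2 * Real.pi * Complex.I * a * ξ) * F ξ) := by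
  have hf : MemLp (fun x => f (x + a)) 2 volume :=
    h.memLp.comp_measurePreserving (measurePreserving_add_right volume a)
  have he : Continuous fun ξ : ℝ => Complex.exp (2 * Real.pi * Complex.I * a * ξ) := by fun_prop
  have hF : MemLp (fun ξ : ℝ => Complex.exp (2 * Real.pi * Complex.I * a * ξ) * F ξ) 2 volume := by
    refine h.memLp_ft.of_le (he.aestronglyMeasurable.mul h.memLp_ft.1)
      (Eventually.of_forall fun ξ => le_of_eq ?_)
    rw [norm_mul, Complex.norm_exp]
    simp
  refine of_forall_integral hf (hF.locallyIntegrable (by norm_num)) ?_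
  intro φ hφ hc
  have h1 : ContDiff ℝ ∞ (fun ξ : ℝ =>
      Complex.exp (2 * Real.pi * Complex.I * a * ξ) * (φ ξ : ℂ)) := by
    refine ContDiff.mul ?_ (Complex.ofRealCLM.contDiff.comp hφ)
    exact Complex.contDiff_exp.comp (contDiff_const.mul Complex.ofRealCLM.contDiff)
  have h2 : HasCompactSupport (fun ξ : ℝ =>
      Complex.exp (2 * Real.pi * Complex.I * a * ξ) * (φ ξ : ℂ)) :=
    HasCompactSupport.mul_left (hc.comp_left (g := Complex.ofReal) rfl)
  have key := h.integral_fourier_mul h1 h2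
  rw [← integral_add_right_eq_self (fun x => (𝓕 _ : ℝ → ℂ) x * f x) a] at key
  refine Eq.trans ?_ (key.trans ?_)
  · refine integral_congr_ae (Eventually.of_forall fun x => ?_)
    simp only
    ring
  · refine integral_congr_ae (Eventually.of_forall fun x => ?_)
    simp only
    congr 1
    rw [Real.fourier_real_eq_integral_exp_smul, Real.fourier_real_eq_integral_exp_smul]
    refine integral_congr_ae (Eventually.of_forall fun y => ?_)
    simp only [smul_eq_mul, ← mul_assoc, ← Complex.exp_add]
    congr 2
    push_cast
    ring

/-- Multiplication by a character becomes translation. -/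
theorem modulate (h : IsFT f F) (a : ℝ) :
    IsFT (fun x => Complex.exp (2 * Real.pi * Complex.I * a * x) * f x) (fun ξ => F (ξ - a)) := by
  -- Modulation is translation seen on the Fourier side. The transform has order four, so four uses
  -- of `reflect` return to `f`.
  refine (h.reflect.translate (-a)).reflect.reflect.reflect.congr
    (Eventually.of_forall fun x => ?_) (Eventually.of_forall fun x => ?_)
  · simp
  · simp [sub_eq_add_neg]

end IsFT

/-! ### The Hilbert transform as a Fourier multiplier. -/

theorem contRep_ae_eq (f : ℝ → ℂ) : contRep f =ᵐ[volume] f := by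
  unfold contRep
  split_ifs with h
  · exact h.choose_spec.2
  · exact ae_eq_refl _

theorem contRep_eq {f g : ℝ → ℂ} (hg : Continuous g) (h : g =ᵐ[volume] f) : contRep f = g := by
  have hex : ∃ g : ℝ → ℂ, Continuous g ∧ g =ᵐ[volume] f := ⟨g, hg, h⟩
  unfold contRep
  rw [dif_pos hex]
  exact Continuous.ae_eq_iff_eq volume hex.choose_spec.1 hg |>.1 (hex.choose_spec.2.trans h.symm)

theorem hilbert_congr {f g : ℝ → ℂ} (h : f =ᵐ[volume] g) : hilbert f = hilbert g := by
  unfold hilbert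
  by_cases hf : MemLp f 2 volume
  · have hg := hf.ae_eq h
    rw [dif_pos hf, dif_pos hg, MemLp.toLp_congr hf hg h]
  · have hg : ¬ MemLp g 2 volume := fun hg => hf (hg.ae_eq h.symm)
    rw [dif_neg hf, dif_neg hg]

namespace IsFT

variable {f F : ℝ → ℂ}

theorem hilbert_ae_eq (h : IsFT f F) :
    hilbert f =ᵐ[volume] hilbertL2 (h.memLp.toLp f) := by
  unfold hilbert
  rw [dif_pos h.memLp]
  exact contRep_ae_eq _

theorem hilbert (h : IsFT f F) :
    IsFT (hilbert f) (fun ξ => -Complex.I * (Real.sign ξ : ℂ) * F ξ) := by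
  have key : IsFT (hilbertL2 (h.memLp.toLp f))
      (fun ξ => -Complex.I * (Real.sign ξ : ℂ) * (𝓕 (h.memLp.toLp f) : Lp ℂ 2 volume) ξ) := by
    refine ⟨Lp.memLp _, memLp_hilbertSymbol_mul _, ?_⟩
    rw [Lp.toLp_coeFn]
    exact (Lp.fourierTransformₗᵢ ℝ ℂ).apply_symm_apply _
  refine key.congr h.hilbert_ae_eq.symm ?_
  rw [h.2.2]
  filter_upwards [h.memLp_ft.coeFn_toLp] with x hx
  rw [hx]

/-- Two continuous functions that agree almost everywhere are equal, so a continuous candidate with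
the right transform gives the value of `hilbert` at every point. -/
theorem hilbert_eq (h : IsFT f F) {g : ℝ → ℂ} (hg : Continuous g)
    (h' : IsFT g (fun ξ => -Complex.I * (Real.sign ξ : ℂ) * F ξ)) : _root_.hilbert f = g := by
  have e : g =ᵐ[volume] hilbertL2 (h.memLp.toLp f) :=
    (h'.ae_eq_left h.hilbert).trans h.hilbert_ae_eq
  unfold _root_.hilbert
  rw [dif_pos h.memLp]
  exact contRep_eq hg e

end IsFT

section HilbertAlgebra

variable {f g : ℝ → ℂ}

theorem hilbert_add (hf : MemLp f 2 volume) (hg : MemLp g 2 volume) :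
    hilbert (fun x => f x + g x) =ᵐ[volume] fun x => hilbert f x + hilbert g x := by
  obtain ⟨F, hF⟩ := IsFT.exists_of_memLp hf
  obtain ⟨G, hG⟩ := IsFT.exists_of_memLp hg
  refine (hF.add hG).hilbert.ae_eq_left ((hF.hilbert.add hG.hilbert).congr (ae_eq_refl _) ?_)
  exact Eventually.of_forall fun x => by ring

theorem hilbert_const_mul (hf : MemLp f 2 volume) (a : ℂ) :
    hilbert (fun x => a * f x) =ᵐ[volume] fun x => a * hilbert f x := by
  obtain ⟨F, hF⟩ := IsFT.exists_of_memLp hf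
  refine (hF.const_mul a).hilbert.ae_eq_left ((hF.hilbert.const_mul a).congr (ae_eq_refl _) ?_)
  exact Eventually.of_forall fun x => by ring

theorem hilbert_star (hf : MemLp f 2 volume) :
    hilbert (fun x => star (f x)) =ᵐ[volume] fun x => star (hilbert f x) := by
  obtain ⟨F, hF⟩ := IsFT.exists_of_memLp hf
  refine hF.star.hilbert.ae_eq_left (hF.hilbert.star.congr (ae_eq_refl _) ?_)
  exact Eventually.of_forall fun x => by simp [Real.sign_neg]

theorem hilbert_translate (hf : MemLp f 2 volume) (a : ℝ) :
    hilbert (fun x => f (x + a)) =ᵐ[volume] fun x => hilbert f (x + a) := by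
  obtain ⟨F, hF⟩ := IsFT.exists_of_memLp hf
  refine (hF.translate a).hilbert.ae_eq_left ((hF.hilbert.translate a).congr (ae_eq_refl _) ?_)
  exact Eventually.of_forall fun x => by simp only; ring

theorem hilbert_ofReal {f : ℝ → ℝ} (hf : MemLp (fun x => (f x : ℂ)) 2 volume) :
    hilbert (fun x => (f x : ℂ)) =ᵐ[volume] fun x => (hilbertReal f x : ℂ) := by
  have h : hilbert (fun x => (f x : ℂ)) = hilbert (fun x => star (f x : ℂ)) := by
    congr 1; funext x; simp
  have h' := hilbert_star hf
  filter_upwards [h'] with x hx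
  rw [← h] at hx
  exact (Complex.conj_eq_iff_re.1 hx.symm).symm

end HilbertAlgebra

/-! ### Functions with one-sided spectrum -/

/-- Square integrable functions all of whose frequencies are nonpositive. -/
def HasNegSpectrum (f : ℝ → ℂ) : Prop := ∃ F, IsFT f F ∧ ∀ᵐ ξ : ℝ, 0 < ξ → F ξ = 0

/-- Square integrable functions all of whose frequencies are nonnegative. -/
def HasPosSpectrum (f : ℝ → ℂ) : Prop := ∃ F, IsFT f F ∧ ∀ᵐ ξ : ℝ, ξ < 0 → F ξ = 0

namespace HasNegSpectrum

variable {f g : ℝ → ℂ}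

theorem memLp (h : HasNegSpectrum f) : MemLp f 2 volume := h.choose_spec.1.memLp

theorem congr (h : HasNegSpectrum f) (hfg : f =ᵐ[volume] g) : HasNegSpectrum g := by
  obtain ⟨F, hF, h0⟩ := h
  exact ⟨F, hF.congr hfg (ae_eq_refl _), h0⟩

theorem add (hf : HasNegSpectrum f) (hg : HasNegSpectrum g) :
    HasNegSpectrum (fun x => f x + g x) := by
  obtain ⟨F, hF, h0⟩ := hf
  obtain ⟨G, hG, h0'⟩ := hg
  refine ⟨_, hF.add hG, ?_⟩
  filter_upwards [h0, h0'] with ξ h1 h2 h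
  rw [h1 h, h2 h, add_zero]

theorem const_mul (hf : HasNegSpectrum f) (a : ℂ) : HasNegSpectrum (fun x => a * f x) := by
  obtain ⟨F, hF, h0⟩ := hf
  refine ⟨_, hF.const_mul a, ?_⟩
  filter_upwards [h0] with ξ h1 h
  rw [h1 h, mul_zero]

theorem neg (hf : HasNegSpectrum f) : HasNegSpectrum (fun x => -f x) := by
  simpa using hf.const_mul (-1)

theorem sub (hf : HasNegSpectrum f) (hg : HasNegSpectrum g) :
    HasNegSpectrum (fun x => f x - g x) := by
  simpa [sub_eq_add_neg] using hf.add hg.neg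

theorem star (hf : HasNegSpectrum f) : HasPosSpectrum (fun x => star (f x)) := by
  obtain ⟨F, hF, h0⟩ := hf
  refine ⟨_, hF.star, ?_⟩
  have := (Measure.measurePreserving_neg (volume : Measure ℝ)).quasiMeasurePreserving.ae h0
  filter_upwards [this] with ξ h1 h
  rw [h1 (by simpa using h), star_zero]

theorem translate (hf : HasNegSpectrum f) (a : ℝ) : HasNegSpectrum (fun x => f (x + a)) := by
  obtain ⟨F, hF, h0⟩ := hf
  refine ⟨_, hF.translate a, ?_⟩
  filter_upwards [h0] with ξ h1 h
  rw [h1 h, mul_zero]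

end HasNegSpectrum

theorem HasPosSpectrum.star {f : ℝ → ℂ} (hf : HasPosSpectrum f) :
    HasNegSpectrum (fun x => star (f x)) := by
  obtain ⟨F, hF, h0⟩ := hf
  refine ⟨_, hF.star, ?_⟩
  have := (Measure.measurePreserving_neg (volume : Measure ℝ)).quasiMeasurePreserving.ae h0
  filter_upwards [this] with ξ h1 h
  rw [h1 (by simpa using h), star_zero]

theorem HasPosSpectrum.congr {f g : ℝ → ℂ} (h : HasPosSpectrum f) (hfg : f =ᵐ[volume] g) :
    HasPosSpectrum g := by
  obtain ⟨F, hF, h0⟩ := h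
  exact ⟨F, hF.congr hfg (ae_eq_refl _), h0⟩

theorem HasPosSpectrum.memLp {f : ℝ → ℂ} (h : HasPosSpectrum f) : MemLp f 2 volume :=
  h.choose_spec.1.memLp

/-- Only the frequency 0 is allowed on both sides, and it is a null set. -/
theorem HasNegSpectrum.ae_eq_zero_of_hasPosSpectrum {f : ℝ → ℂ} (hf : HasNegSpectrum f)
    (hf' : HasPosSpectrum f) : f =ᵐ[volume] 0 := by
  obtain ⟨F, hF, h0⟩ := hf
  obtain ⟨G, hG, h0'⟩ := hf'
  have e : F =ᵐ[volume] fun ξ => (0 : ℂ) * F ξ := by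
    filter_upwards [h0, h0', hF.ae_eq_right hG, Measure.ae_ne volume (0 : ℝ)] with ξ h1 h2 h3 h4
    rcases lt_or_gt_of_ne h4 with h | h
    · rw [h3, h2 h]; simp
    · rw [h1 h]; simp
  have := (hF.congr (ae_eq_refl _) e).ae_eq_left (hF.const_mul 0)
  filter_upwards [this] with x hx
  simpa using hx

/-- Real-valued functions with nonpositive frequencies vanish. -/
theorem HasNegSpectrum.ae_eq_zero_of_star_eq {f : ℝ → ℂ} (hf : HasNegSpectrum f)
    (h : ∀ᵐ x, Star.star (f x) = f x) : f =ᵐ[volume] 0 :=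
  hf.ae_eq_zero_of_hasPosSpectrum (hf.star.congr h)

/-- Imaginary-valued functions with nonpositive frequencies vanish. -/
theorem HasNegSpectrum.ae_eq_zero_of_re_eq_zero {f : ℝ → ℂ} (hf : HasNegSpectrum f)
    (h : ∀ᵐ x, (f x).re = 0) : f =ᵐ[volume] 0 := by
  have h1 : (fun x => Complex.I * f x) =ᵐ[volume] 0 := by
    refine (hf.const_mul Complex.I).ae_eq_zero_of_star_eq ?_
    filter_upwards [h] with x hx
    apply Complex.ext <;> simp [hx]
  filter_upwards [h1] with x hx
  simpa using hx

theorem HasNegSpectrum.hilbert_ae_eq {f : ℝ → ℂ} (hf : HasNegSpectrum f) :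
    hilbert f =ᵐ[volume] fun x => Complex.I * f x := by
  obtain ⟨F, hF, h0⟩ := hf
  refine hF.hilbert.ae_eq_left ((hF.const_mul Complex.I).congr (ae_eq_refl _) ?_)
  filter_upwards [h0, Measure.ae_ne volume (0 : ℝ)] with ξ h1 h4
  rcases lt_or_gt_of_ne h4 with h | h
  · simp [Real.sign_of_neg h]
  · simp [h1 h]

theorem HasPosSpectrum.hilbert_ae_eq {f : ℝ → ℂ} (hf : HasPosSpectrum f) :
    hilbert f =ᵐ[volume] fun x => -Complex.I * f x := by
  obtain ⟨F, hF, h0⟩ := hf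
  refine hF.hilbert.ae_eq_left ((hF.const_mul (-Complex.I)).congr (ae_eq_refl _) ?_)
  filter_upwards [h0, Measure.ae_ne volume (0 : ℝ)] with ξ h1 h4
  rcases lt_or_gt_of_ne h4 with h | h
  · simp [h1 h]
  · simp [Real.sign_of_pos h]

theorem hasNegSpectrum_projNeg {f : ℝ → ℂ} (hf : MemLp f 2 volume) :
    HasNegSpectrum (projNeg f) := by
  obtain ⟨F, hF⟩ := IsFT.exists_of_memLp hf
  have h := (hF.sub (hF.hilbert.const_mul Complex.I)).const_mul (1 / 2)
  refine ⟨_, h.congr (Eventually.of_forall fun x => ?_) (ae_eq_refl _),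
    Eventually.of_forall fun ξ hξ => ?_⟩
  · simp only [projNeg]; ring
  · simp [Real.sign_of_pos hξ, ← mul_assoc]

theorem hasPosSpectrum_sub_projNeg {f : ℝ → ℂ} (hf : MemLp f 2 volume) :
    HasPosSpectrum (fun x => f x - projNeg f x) := by
  obtain ⟨F, hF⟩ := IsFT.exists_of_memLp hf
  have h := (hF.add (hF.hilbert.const_mul Complex.I)).const_mul (1 / 2)
  refine ⟨_, h.congr (Eventually.of_forall fun x => ?_) (ae_eq_refl _),
    Eventually.of_forall fun ξ hξ => ?_⟩
  · simp only [projNeg]; ring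
  · simp [Real.sign_of_neg hξ, ← mul_assoc]

/-- The symbol of P is 1 on negative and 0 on positive frequencies. All projections of the water
wave system are evaluated through such a splitting. -/
theorem projNeg_ae_eq_of_add {f n p : ℝ → ℂ} (hn : HasNegSpectrum n) (hp : HasPosSpectrum p)
    (h : ∀ᵐ x, f x = n x + p x) : projNeg f =ᵐ[volume] n := by
  have e := hilbert_congr h
  filter_upwards [hilbert_add hn.memLp hp.memLp, hn.hilbert_ae_eq, hp.hilbert_ae_eq, h]
    with x h1 h2 h3 h4
  have h5 : hilbert f x = _ := (congrFun e x).trans h1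
  simp only [projNeg]
  rw [h5, h2, h3, h4]
  linear_combination (-(n x) / 2 + p x / 2) * Complex.I_mul_I

theorem projNeg_sub_const_mul {f g : ℝ → ℂ} (hf : MemLp f 2 volume) (hg : MemLp g 2 volume)
    (a : ℂ) : projNeg (fun x => f x - a * g x) =ᵐ[volume] fun x => projNeg f x - a * projNeg g x := by
  have h1 := hilbert_add hf (hg.const_mul (-a))
  have h2 := hilbert_const_mul hg (-a)
  have e : hilbert (fun x => f x - a * g x) = hilbert (fun x => f x + -a * g x) := by
    congr 1; funext x; ring
  filter_upwards [h1, h2] with x h3 h4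
  simp only [projNeg]
  rw [e, h3, h4]
  ring

theorem projNeg_translate {f : ℝ → ℂ} (hf : MemLp f 2 volume) (a : ℝ) :
    projNeg (fun x => f (x + a)) =ᵐ[volume] fun x => projNeg f (x + a) := by
  filter_upwards [hilbert_translate hf a] with x hx
  simp only [projNeg, hx]

/-- The product of two functions with nonpositive frequencies has nonpositive frequencies. -/
theorem HasNegSpectrum.mul {f g : ℝ → ℂ} (hf : HasNegSpectrum f) (hg : HasNegSpectrum g)
    (hfg : MemLp (fun x => f x * g x) 2 volume) : HasNegSpectrum (fun x => f x * g x) := by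
  have hi : Integrable (fun x => f x * g x) := hf.memLp.integrable_mul hg.memLp
  refine ⟨_, IsFT.of_integrable hfg hi, Eventually.of_forall fun ξ hξ => ?_⟩
  obtain ⟨F, hF, h0⟩ := hf.star
  obtain ⟨G, hG, h0'⟩ := hg
  -- The transform of the product at ξ is the pairing of the conjugate of `f` with a modulation of
  -- `g`, that is, the integral of conj F(η) · G(η + ξ). F lives on η ≥ 0, and there η + ξ > 0, so G
  -- vanishes.
  have key := hF.integral_star_mul (hG.modulate (-ξ))
  rw [Real.fourier_real_eq_integral_exp_smul]
  refine Eq.trans ?_ (key.trans ?_)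
  · refine integral_congr_ae (Eventually.of_forall fun x => ?_)
    simp only [smul_eq_mul, star_star]
    rw [show (2 * Real.pi * Complex.I * ((-ξ : ℝ) : ℂ) * x : ℂ)
      = ((-2 * Real.pi * x * ξ : ℝ) : ℂ) * Complex.I by push_cast; ring]
    ring
  · have h0'' := (measurePreserving_add_right (volume : Measure ℝ) ξ).quasiMeasurePreserving.ae h0'
    rw [← integral_zero ℝ ℂ]
    refine integral_congr_ae ?_
    filter_upwards [h0, h0''] with η h1 h2
    rcases lt_or_ge η 0 with h | h
    · simp [h1 h]
    · have : G (η - -ξ) = 0 := by simpa using h2 (by linarith)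
      rw [this, mul_zero]

/-! ### The Sobolev space `H¹` -/

theorem memLp_two_inv_one_add_mul_I :
    MemLp (fun ξ : ℝ => (1 + (ξ : ℂ) * Complex.I)⁻¹) 2 volume := by
  have hne : ∀ ξ : ℝ, (1 + (ξ : ℂ) * Complex.I) ≠ 0 := by
    intro ξ h
    have := congrArg Complex.re h
    simp at this
  have hc : Continuous (fun ξ : ℝ => (1 + (ξ : ℂ) * Complex.I)⁻¹) :=
    Continuous.inv₀ (by fun_prop) hne
  refine (memLp_two_iff_integrable_sq_norm hc.aestronglyMeasurable).2 ?_
  refine integrable_inv_one_add_sq.congr (Eventually.of_forall fun ξ => ?_)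
  simp only [norm_inv, inv_pow]
  rw [← Complex.normSq_eq_norm_sq]
  congr 1
  simp [Complex.normSq_apply, sq]

/-- V is the product of the L² functions (1 + iξ)⁻¹ and V + iξV. -/
theorem integrable_of_memLp_two_mul {V : ℝ → ℂ} (hV : MemLp V 2 volume)
    (hV' : MemLp (fun ξ : ℝ => (ξ : ℂ) * V ξ) 2 volume) : Integrable V := by
  have h := memLp_two_inv_one_add_mul_I.integrable_mul (hV.add (hV'.const_mul Complex.I))
  refine h.congr (Eventually.of_forall fun ξ => ?_)
  have hne : (1 + (ξ : ℂ) * Complex.I) ≠ 0 := by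
    intro h
    have := congrArg Complex.re h
    simp at this
  simp only [Pi.mul_apply, Pi.add_apply]
  field_simp

/-- The integral of the character of frequency `ξ` over an interval. -/
def charIntegral (a b ξ : ℝ) : ℂ := ∫ x in a..b, Complex.exp (2 * Real.pi * Complex.I * ξ * x)

theorem two_pi_I_mul_charIntegral (a b ξ : ℝ) :
    2 * Real.pi * Complex.I * ξ * charIntegral a b ξ
      = Complex.exp (2 * Real.pi * Complex.I * ξ * b)
        - Complex.exp (2 * Real.pi * Complex.I * ξ * a) := by
  by_cases h : ξ = 0
  · simp [h]
  have hc : 2 * Real.pi * Complex.I * ξ ≠ 0 := by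
    simp [h, Real.pi_ne_zero]
  rw [charIntegral, integral_exp_mul_complex hc, mul_div_cancel₀ _ hc]

theorem charIntegral_symm (a b ξ : ℝ) : charIntegral a b ξ = -charIntegral b a ξ :=
  intervalIntegral.integral_symm _ _

theorem charIntegral_add_one (x ξ : ℝ) :
    charIntegral x (x + 1) ξ = Complex.exp (2 * Real.pi * Complex.I * ξ * x) * charIntegral 0 1 ξ := by
  unfold charIntegral
  have h := intervalIntegral.integral_comp_add_right
    (f := fun y : ℝ => Complex.exp (2 * Real.pi * Complex.I * ξ * y)) (a := 0) (b := 1) x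
  rw [zero_add, add_comm (1 : ℝ) x] at h
  rw [← h, ← intervalIntegral.integral_const_mul]
  refine intervalIntegral.integral_congr fun y _ => ?_
  simp only [← Complex.exp_add]
  congr 1
  push_cast
  ring

theorem isFT_charIntegral {a b : ℝ} (hab : a ≤ b) :
    IsFT ((Set.Ioc a b).indicator fun _ => 1) (fun ξ => star (charIntegral a b ξ)) := by
  have hm : MemLp ((Set.Ioc a b).indicator fun _ => (1 : ℂ)) 2 (volume : Measure ℝ) :=
    memLp_indicator_const 2 measurableSet_Ioc 1 (Or.inr (by simp))
  have hi : Integrable ((Set.Ioc a b).indicator fun _ => (1 : ℂ)) (volume : Measure ℝ) := by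
    rw [integrable_indicator_iff measurableSet_Ioc]
    exact integrableOn_const (by simp)
  refine (IsFT.of_integrable hm hi).congr (ae_eq_refl _) (Eventually.of_forall fun ξ => ?_)
  simp only
  rw [Real.fourier_real_eq_integral_exp_smul, charIntegral,
    intervalIntegral.integral_of_le hab]
  change _ = (starRingEnd ℂ) _
  rw [← integral_conj, ← integral_indicator measurableSet_Ioc]
  refine integral_congr_ae (Eventually.of_forall fun x => ?_)
  by_cases hx : x ∈ Set.Ioc a b
  · simp only [Set.indicator_of_mem hx, ← Complex.exp_conj]
    simp [Complex.conj_ofNat]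
    ring_nf
  · simp [Set.indicator_of_notMem hx]

/-- Plancherel against the indicator of the interval, which needs no integrability of the transform
of `w`. -/
theorem IsFT.intervalIntegral_eq {w Z : ℝ → ℂ} (h : IsFT w Z) (a b : ℝ) :
    ∫ x in a..b, w x = ∫ ξ, charIntegral a b ξ * Z ξ := by
  wlog hab : a ≤ b generalizing a b
  · rw [intervalIntegral.integral_symm, this b a (le_of_not_ge hab), ← integral_neg]
    refine integral_congr_ae (Eventually.of_forall fun x => ?_)
    simp only
    rw [charIntegral_symm a b]
    ring
  have key := (isFT_charIntegral hab).integral_star_mul h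
  simp only [star_star] at key
  rw [← key, intervalIntegral.integral_of_le hab, ← integral_indicator measurableSet_Ioc]
  refine integral_congr_ae (Eventually.of_forall fun x => ?_)
  by_cases hx : x ∈ Set.Ioc a b
  · simp [Set.indicator_of_mem hx]
  · simp [Set.indicator_of_notMem hx]

/-- `v` belongs to `H¹(ℝ)` and `w` is its weak derivative. -/
structure IsH1 (v w : ℝ → ℂ) : Prop where
  continuous : Continuous v
  memLp : MemLp v 2 volume
  memLp_deriv : MemLp w 2 volume
  integral_eq : ∀ a b, v b - v a = ∫ x in a..b, w x

theorem continuous_fourierInv {V : ℝ → ℂ} (hV : Integrable V) : Continuous (𝓕⁻ V) := by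
  have h : Continuous (𝓕 V) := VectorFourier.fourierIntegral_continuous
    Real.continuous_fourierChar (by exact continuous_inner) hV
  have e : 𝓕⁻ V = fun x => 𝓕 V (-x) := funext fun x => Real.fourierInv_eq_fourier_neg _ _
  rw [e]
  exact h.comp continuous_neg

theorem ae_exp_two_pi_I_ne_one : ∀ᵐ ξ : ℝ, Complex.exp (2 * Real.pi * Complex.I * ξ) ≠ 1 := by
  have h : (Set.range ((↑) : ℤ → ℝ)).Countable := Set.countable_range _
  have h0 := h.measure_zero volume
  rw [measure_eq_zero_iff_ae_notMem] at h0
  filter_upwards [h0] with ξ hξ h1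
  obtain ⟨n, hn⟩ := Complex.exp_eq_one_iff.1 h1
  refine hξ ⟨n, ?_⟩
  have hc : (2 * Real.pi * Complex.I : ℂ) ≠ 0 := by simp [Real.pi_ne_zero]
  have : (ξ : ℂ) = n := mul_left_cancel₀ hc (by rw [hn]; ring)
  exact_mod_cast this.symm

/-- The unit difference v(x + 1) - v(x) is both a translate minus v and the integral of w over [x, x
+ 1]. Comparing the two transforms and dividing by exp(2πiξ) - 1, which is nonzero unless ξ is an
integer, gives the rule. -/
theorem IsH1.ft_deriv {v w V Z : ℝ → ℂ} (h : IsH1 v w) (hV : IsFT v V) (hZ : IsFT w Z) :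
    Z =ᵐ[volume] fun ξ => 2 * Real.pi * Complex.I * ξ * V ξ := by
  have hchar := isFT_charIntegral (zero_le_one' ℝ)
  have hchar' : MemLp (charIntegral 0 1) 2 volume := by
    exact hchar.memLp_ft.star.ae_eq (Eventually.of_forall fun ξ => star_star _)
  have hbound : ∀ ξ, ‖charIntegral 0 1 ξ‖ ≤ 1 := by
    intro ξ
    have := intervalIntegral.norm_integral_le_of_norm_le_const (a := 0) (b := 1) (C := 1)
      (f := fun x : ℝ => Complex.exp (2 * Real.pi * Complex.I * ξ * x)) (fun x _ => by
        rw [Complex.norm_exp]; simp)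
    simpa [charIntegral] using this
  have hi : Integrable (fun ξ => charIntegral 0 1 ξ * Z ξ) :=
    hchar'.integrable_mul hZ.memLp_ft
  have hm : MemLp (fun ξ => charIntegral 0 1 ξ * Z ξ) 2 volume := by
    refine hZ.memLp_ft.of_le (hchar'.1.mul hZ.memLp_ft.1) (Eventually.of_forall fun ξ => ?_)
    rw [norm_mul]
    exact mul_le_of_le_one_left (norm_nonneg _) (hbound ξ)
  have h1 : IsFT (fun x => v (x + 1) - v x) (fun ξ => charIntegral 0 1 ξ * Z ξ) := by
    refine (IsFT.fourierInv_of_integrable hm hi).congr (Eventually.of_forall fun x => ?_)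
      (ae_eq_refl _)
    simp only
    rw [h.integral_eq x (x + 1), hZ.intervalIntegral_eq, Real.fourierInv_eq']
    refine integral_congr_ae (Eventually.of_forall fun ξ => ?_)
    simp only
    rw [charIntegral_add_one, smul_eq_mul, mul_assoc (Complex.exp _)]
    congr 2
    simp
    ring
  have h2 := (hV.translate 1).sub hV
  filter_upwards [h1.ae_eq_right h2, ae_exp_two_pi_I_ne_one] with ξ h3 h4
  have h5 := two_pi_I_mul_charIntegral 0 1 ξ
  simp only [Complex.ofReal_one, mul_one, Complex.ofReal_zero, mul_zero, Complex.exp_zero] at h3 h5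
  have h6 : Complex.exp (2 * Real.pi * Complex.I * ξ) - 1 ≠ 0 := sub_ne_zero.2 h4
  refine mul_left_cancel₀ h6 ?_
  linear_combination 2 * Real.pi * Complex.I * ξ * h3 - Z ξ * h5

theorem IsFT.memLp_mul_of_deriv {w V : ℝ → ℂ}
    (hZ : IsFT w (fun ξ => 2 * Real.pi * Complex.I * ξ * V ξ)) :
    MemLp (fun ξ : ℝ => (ξ : ℂ) * V ξ) 2 volume := by
  refine (hZ.memLp_ft.const_mul (2 * Real.pi * Complex.I)⁻¹).ae_eq
    (Eventually.of_forall fun ξ => ?_)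
  have hc : (2 * Real.pi * Complex.I : ℂ) ≠ 0 := by simp [Real.pi_ne_zero]
  simp only [mul_assoc] at hc ⊢
  field_simp

theorem isH1_fourierInv {w V : ℝ → ℂ} (hV : MemLp V 2 volume)
    (hZ : IsFT w (fun ξ => 2 * Real.pi * Complex.I * ξ * V ξ)) : IsH1 (𝓕⁻ V) w := by
  have hi : Integrable V := integrable_of_memLp_two_mul hV hZ.memLp_mul_of_deriv
  refine ⟨continuous_fourierInv hi, (IsFT.fourierInv_of_integrable hV hi).memLp, hZ.memLp, ?_⟩
  intro a b
  have hexp : ∀ x : ℝ, Integrable (fun ξ : ℝ =>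
      Complex.exp (2 * Real.pi * Complex.I * ξ * x) * V ξ) := by
    intro x
    refine hi.bdd_mul (c := 1) (Continuous.aestronglyMeasurable (by fun_prop))
      (Eventually.of_forall fun ξ => ?_)
    rw [Complex.norm_exp]; simp
  rw [hZ.intervalIntegral_eq, Real.fourierInv_eq', Real.fourierInv_eq']
  have e : ∀ x : ℝ, ∫ ξ : ℝ, Complex.exp (↑(2 * Real.pi * inner ℝ ξ x) * Complex.I) • V ξ
      = ∫ ξ : ℝ, Complex.exp (2 * Real.pi * Complex.I * ξ * x) * V ξ := by
    intro x
    refine integral_congr_ae (Eventually.of_forall fun ξ => ?_)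
    simp only [smul_eq_mul]
    congr 2
    simp
    ring
  rw [e, e, ← integral_sub (hexp b) (hexp a)]
  refine integral_congr_ae (Eventually.of_forall fun ξ => ?_)
  simp only
  rw [← sub_mul, ← two_pi_I_mul_charIntegral]
  ring

theorem isH1_of_isFT {v w V : ℝ → ℂ} (hv : Continuous v) (hV : IsFT v V)
    (hZ : IsFT w (fun ξ => 2 * Real.pi * Complex.I * ξ * V ξ)) : IsH1 v w := by
  have h := isH1_fourierInv hV.memLp_ft hZ
  have hi : Integrable V := integrable_of_memLp_two_mul hV.memLp_ft hZ.memLp_mul_of_deriv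
  have e := (IsFT.fourierInv_of_integrable hV.memLp_ft hi).ae_eq_left hV
  rwa [Continuous.ae_eq_iff_eq volume h.continuous hv |>.1 e] at h

namespace IsH1

variable {v w v₂ w₂ : ℝ → ℂ}

theorem exists_ft (h : IsH1 v w) : ∃ V, IsFT v V ∧ Integrable V ∧ v = 𝓕⁻ V ∧
    IsFT w (fun ξ => 2 * Real.pi * Complex.I * ξ * V ξ) := by
  obtain ⟨V, hV⟩ := IsFT.exists_of_memLp h.memLp
  obtain ⟨Z, hZ⟩ := IsFT.exists_of_memLp h.memLp_deriv
  have hZ' := hZ.congr (ae_eq_refl _) (h.ft_deriv hV hZ)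
  have hi : Integrable V := integrable_of_memLp_two_mul hV.memLp_ft hZ'.memLp_mul_of_deriv
  refine ⟨V, hV, hi, ?_, hZ'⟩
  have e := (IsFT.fourierInv_of_integrable hV.memLp_ft hi).ae_eq_left hV
  exact (Continuous.ae_eq_iff_eq volume (continuous_fourierInv hi) h.continuous |>.1 e).symm

theorem tendsto_zero (h : IsH1 v w) : Tendsto v (cocompact ℝ) (𝓝 0) := by
  obtain ⟨V, -, -, e, -⟩ := h.exists_ft
  have e' : v = fun x => 𝓕 V (-x) := by
    rw [e]; exact funext fun x => Real.fourierInv_eq_fourier_neg _ _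
  rw [e']
  exact (Real.zero_at_infty_fourier V).comp (Homeomorph.neg ℝ).isClosedEmbedding.tendsto_cocompact

theorem exists_bound (h : IsH1 v w) : ∃ C, ∀ x, ‖v x‖ ≤ C := by
  obtain ⟨V, -, -, e, -⟩ := h.exists_ft
  refine ⟨∫ ξ, ‖V ξ‖, fun x => ?_⟩
  rw [e, Real.fourierInv_eq_fourier_neg]
  exact VectorFourier.norm_fourierIntegral_le_integral_norm _ _ _ _ _

theorem eq_integral (h : IsH1 v w) : v = fun x => v 0 + ∫ t in (0 : ℝ)..x, w t :=
  funext fun x => by rw [← h.integral_eq]; ring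

theorem ae_hasDerivAt (h : IsH1 v w) : ∀ᵐ x, HasDerivAt v (w x) x := by
  have hl : LocallyIntegrable w volume := h.memLp_deriv.locallyIntegrable (by norm_num)
  filter_upwards [LocallyIntegrable.ae_hasDerivAt_integral hl] with x hx
  rw [h.eq_integral]
  exact (hx 0).const_add _

theorem hasDerivAt (h : IsH1 v w) (hw : Continuous w) (x : ℝ) : HasDerivAt v (w x) x := by
  rw [h.eq_integral]
  exact (intervalIntegral.integral_hasDerivAt_right (hw.intervalIntegrable _ _)
    (hw.stronglyMeasurableAtFilter _ _) hw.continuousAt).const_add _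

theorem deriv_eq (h : IsH1 v w) (hw : Continuous w) : deriv v = w :=
  funext fun x => (h.hasDerivAt hw x).deriv

theorem add (h : IsH1 v w) (h₂ : IsH1 v₂ w₂) :
    IsH1 (fun x => v x + v₂ x) (fun x => w x + w₂ x) := by
  refine ⟨h.continuous.add h₂.continuous, h.memLp.add h₂.memLp,
    h.memLp_deriv.add h₂.memLp_deriv, fun a b => ?_⟩
  have hl := (h.memLp_deriv.locallyIntegrable (by norm_num)).integrableOn_isCompact
    (isCompact_uIcc (a := a) (b := b))
  have hl₂ := (h₂.memLp_deriv.locallyIntegrable (by norm_num)).integrableOn_isCompact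
    (isCompact_uIcc (a := a) (b := b))
  rw [intervalIntegral.integral_add hl.intervalIntegrable hl₂.intervalIntegrable,
    ← h.integral_eq, ← h₂.integral_eq]
  ring

theorem const_mul (h : IsH1 v w) (c : ℂ) : IsH1 (fun x => c * v x) (fun x => c * w x) := by
  refine ⟨h.continuous.const_mul c, h.memLp.const_mul c, h.memLp_deriv.const_mul c, fun a b => ?_⟩
  rw [intervalIntegral.integral_const_mul, ← h.integral_eq]
  ring

theorem translate (h : IsH1 v w) (s : ℝ) : IsH1 (fun x => v (x + s)) (fun x => w (x + s)) := by
  refine ⟨h.continuous.comp (continuous_add_const s),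
    h.memLp.comp_measurePreserving (measurePreserving_add_right volume s),
    h.memLp_deriv.comp_measurePreserving (measurePreserving_add_right volume s), fun a b => ?_⟩
  rw [h.integral_eq, intervalIntegral.integral_comp_add_right]

/-- The multiplier commutes with 2πiξ. The new transform is still integrable, so its inverse
integral is continuous and is the representative chosen by `hilbert`. -/
theorem hilbert (h : IsH1 v w) : IsH1 (hilbert v) (hilbert w) := by
  obtain ⟨V, hV, hi, e, hZ⟩ := h.exists_ft
  have hV' := hV.hilbert
  have hZ' : IsFT (_root_.hilbert w)
      (fun ξ => 2 * Real.pi * Complex.I * ξ * (-Complex.I * (Real.sign ξ : ℂ) * V ξ)) :=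
    hZ.hilbert.congr (ae_eq_refl _) (Eventually.of_forall fun ξ => by simp only; ring)
  have h1 := isH1_fourierInv hV'.memLp_ft hZ'
  have hi' : Integrable (fun ξ => -Complex.I * (Real.sign ξ : ℂ) * V ξ) :=
    integrable_of_memLp_two_mul hV'.memLp_ft hZ'.memLp_mul_of_deriv
  rwa [← hV.hilbert_eq h1.continuous (IsFT.fourierInv_of_integrable hV'.memLp_ft hi')] at h1

theorem hasNegSpectrum (h : IsH1 v w) (hv : HasNegSpectrum v) : HasNegSpectrum w := by
  obtain ⟨V, hV, hi, e, hZ⟩ := h.exists_ft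
  obtain ⟨V', hV', h0⟩ := hv
  refine ⟨_, hZ, ?_⟩
  filter_upwards [h0, hV.ae_eq_right hV'] with ξ h1 h2 hξ
  rw [h2, h1 hξ, mul_zero]

end IsH1

/-! ### The Sobolev space `H²` -/

theorem hasTemperateGrowth_one_add_norm_sq :
    Function.HasTemperateGrowth (fun ξ : ℝ => (((1 + ‖ξ‖ ^ 2) ^ ((2 : ℝ) / 2) : ℝ) : ℂ)) := by
  fun_prop

/-- The Bessel weight of order 2 is (1 + ξ²)^(2/2) = 1 + ξ²; both sides are compared as
distributions acting on test functions. -/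
theorem IsFT.memSobolev_two_iff {f F : ℝ → ℂ} (h : IsFT f F) :
    TemperedDistribution.MemSobolev 2 2 (h.memLp.toLp f : TemperedDistribution ℝ ℂ) ↔
      MemLp (fun ξ : ℝ => (1 + (ξ : ℂ) ^ 2) * F ξ) 2 volume := by
  have hg := hasTemperateGrowth_one_add_norm_sq
  have e0 : ∀ ξ : ℝ, (((1 + ‖ξ‖ ^ 2) ^ ((2 : ℝ) / 2) : ℝ) : ℂ) = 1 + (ξ : ℂ) ^ 2 := by
    intro ξ
    simp
  have hT : ∀ φ : 𝓢(ℝ, ℂ), TemperedDistribution.smulLeftCLM ℂ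
      (fun ξ : ℝ => (((1 + ‖ξ‖ ^ 2) ^ ((2 : ℝ) / 2) : ℝ) : ℂ))
      (𝓕 (h.memLp.toLp f : TemperedDistribution ℝ ℂ)) φ
      = ∫ ξ, φ ξ * ((1 + (ξ : ℂ) ^ 2) * F ξ) := by
    intro φ
    rw [Lp.fourier_toTemperedDistribution_eq, h.2.2, TemperedDistribution.smulLeftCLM_apply_apply,
      Lp.toTemperedDistribution_apply]
    refine integral_congr_ae ?_
    filter_upwards [h.memLp_ft.coeFn_toLp] with ξ hξ
    rw [hξ, SchwartzMap.smulLeftCLM_apply_apply hg, e0]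
    simp only [smul_eq_mul]
    ring
  rw [TemperedDistribution.memSobolev_iff_exists_smulLeftCLM_fourier]
  constructor
  · rintro ⟨G, hG⟩
    refine (Lp.memLp G).ae_eq ?_
    have hl : LocallyIntegrable (fun ξ : ℝ => (1 + (ξ : ℂ) ^ 2) * F ξ) volume := by
      refine LocallyIntegrable.continuous_mul ?_ (h.memLp_ft.locallyIntegrable (by norm_num))
      fun_prop
    refine ae_eq_of_integral_contDiff_smul_eq ((Lp.memLp G).locallyIntegrable (by norm_num)) hl ?_
    intro φ hφ hc
    have h1 : ContDiff ℝ ∞ (fun y => (φ y : ℂ)) := Complex.ofRealCLM.contDiff.comp hφ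
    have h2 : HasCompactSupport (fun y => (φ y : ℂ)) := hc.comp_left (g := Complex.ofReal) rfl
    have key := congrArg (fun T : TemperedDistribution ℝ ℂ => T (h2.toSchwartzMap h1)) hG
    simp only [hT, Lp.toTemperedDistribution_apply] at key
    simpa using key.symm
  · intro hm
    refine ⟨hm.toLp _, ?_⟩
    ext φ
    rw [hT, Lp.toTemperedDistribution_apply]
    refine integral_congr_ae ?_
    filter_upwards [hm.coeFn_toLp] with ξ hξ
    rw [hξ, smul_eq_mul]

theorem IsH1.memH2 {f f' f'' : ℝ → ℂ} (h : IsH1 f f') (h' : IsH1 f' f'') : MemH2 f := by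
  obtain ⟨F, hF, -, -, hF'⟩ := h.exists_ft
  obtain ⟨F', hF1, -, -, hF''⟩ := h'.exists_ft
  refine ⟨h.continuous, hF.memLp, hF.memSobolev_two_iff.2 ?_⟩
  refine (hF.memLp_ft.add (hF''.memLp_ft.const_mul (2 * Real.pi * Complex.I)⁻¹ |>.const_mul
    (2 * Real.pi * Complex.I)⁻¹)).ae_eq ?_
  filter_upwards [hF1.ae_eq_right hF'] with ξ hξ
  simp only [Pi.add_apply]
  rw [hξ]
  have hc : (2 * Real.pi * Complex.I : ℂ) ≠ 0 := by simp [Real.pi_ne_zero]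
  generalize (2 * Real.pi * Complex.I : ℂ) = k at hc
  field_simp

theorem MemH2.exists_isH1 {f : ℝ → ℂ} (h : MemH2 f) :
    ∃ f' f'', IsH1 f f' ∧ IsH1 f' f'' := by
  obtain ⟨hc, hm, hs⟩ := h
  obtain ⟨F, hF⟩ := IsFT.exists_of_memLp hm
  have h2 : MemLp (fun ξ : ℝ => (1 + (ξ : ℂ) ^ 2) * F ξ) 2 volume := hF.memSobolev_two_iff.1 hs
  have hlow : ∀ ξ : ℝ, 1 + |ξ| + ξ ^ 2 ≤ 2 * ‖(1 + (ξ : ℂ) ^ 2)‖ := by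
    intro ξ
    have : ‖(1 + (ξ : ℂ) ^ 2)‖ = 1 + ξ ^ 2 := by
      rw [show (1 + (ξ : ℂ) ^ 2) = ((1 + ξ ^ 2 : ℝ) : ℂ) by push_cast; ring, Complex.norm_real,
        Real.norm_of_nonneg (by positivity)]
    rw [this]
    nlinarith [sq_nonneg (|ξ| - 1), sq_abs ξ]
  -- The constant 40 is a generous bound covering the factor 2π below; 80 is 40 times the factor 2
  -- of `hlow`.
  have bound : ∀ a : ℝ → ℂ, Continuous a → (∀ ξ, ‖a ξ‖ ≤ 40 * (1 + |ξ| + ξ ^ 2)) →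
      MemLp (fun ξ => a ξ * F ξ) 2 volume := by
    intro a ha hb
    refine (h2.const_mul 80).of_le (ha.aestronglyMeasurable.mul hF.memLp_ft.1)
      (Eventually.of_forall fun ξ => ?_)
    rw [norm_mul, norm_mul, norm_mul, ← mul_assoc]
    refine mul_le_mul_of_nonneg_right ?_ (norm_nonneg _)
    have := hb ξ
    have := hlow ξ
    norm_num
    linarith
  have hpi := Real.pi_le_four
  have hpi0 := Real.pi_pos
  have m1 : MemLp (fun ξ : ℝ => 2 * Real.pi * Complex.I * ξ * F ξ) 2 volume := by
    refine bound _ (by fun_prop) fun ξ => ?_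
    simp only [norm_mul, Complex.norm_I, Complex.norm_real, Complex.norm_ofNat, Real.norm_eq_abs,
      abs_of_pos hpi0]
    nlinarith [abs_nonneg ξ, sq_nonneg ξ]
  have m2 : MemLp (fun ξ : ℝ => 2 * Real.pi * Complex.I * ξ * (2 * Real.pi * Complex.I * ξ * F ξ))
      2 volume := by
    have hb : MemLp (fun ξ : ℝ => ((ξ : ℂ) ^ 2) * F ξ) 2 volume := by
      refine bound _ (by fun_prop) fun ξ => ?_
      simp only [norm_pow, Complex.norm_real, Real.norm_eq_abs, sq_abs]
      nlinarith [abs_nonneg ξ, sq_nonneg ξ]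
    refine (hb.const_mul ((2 * Real.pi * Complex.I) ^ 2)).ae_eq
      (Eventually.of_forall fun ξ => ?_)
    simp only
    ring
  obtain ⟨f'', hf''⟩ := IsFT.exists_of_memLp_ft m2
  have h1 := isH1_fourierInv m1 hf''
  have hi : Integrable (fun ξ : ℝ => 2 * Real.pi * Complex.I * ξ * F ξ) :=
    integrable_of_memLp_two_mul m1 hf''.memLp_mul_of_deriv
  exact ⟨_, f'', isH1_of_isFT hc hF (IsFT.fourierInv_of_integrable m1 hi), h1⟩

/-- Products of real-valued `H¹` functions. -/
theorem IsH1.ofReal_mul {f f' g g' : ℝ → ℝ} (hf : IsH1 (fun x => (f x : ℂ)) (fun x => (f' x : ℂ)))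
    (hg : IsH1 (fun x => (g x : ℂ)) (fun x => (g' x : ℂ))) :
    IsH1 (fun x => ((f x * g x : ℝ) : ℂ)) (fun x => ((f' x * g x + f x * g' x : ℝ) : ℂ)) := by
  have key : ∀ {f f' : ℝ → ℝ}, IsH1 (fun x => (f x : ℂ)) (fun x => (f' x : ℂ)) →
      Continuous f ∧ MemLp f' 2 volume ∧
      (∀ a b, AbsolutelyContinuousOnInterval f a b) ∧ ∀ᵐ x, HasDerivAt f (f' x) x := by
    intro f f' hf
    have hm : MemLp f' 2 volume := by simpa using hf.memLp_deriv.re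
    have hl := hm.locallyIntegrable (by norm_num)
    have hi : ∀ a b, IntervalIntegrable f' volume a b := fun a b =>
      (hl.integrableOn_isCompact isCompact_uIcc).intervalIntegrable
    refine ⟨Complex.continuous_re.comp hf.continuous, hm, fun a b => ?_, ?_⟩
    · have e : f = fun x => f a + ∫ t in a..x, f' t := by
        funext x
        have := hf.integral_eq a x
        rw [intervalIntegral.integral_ofReal] at this
        have : f x - f a = ∫ t in a..x, f' t := by exact_mod_cast this
        linarith
      have h1 := (hi a b).absolutelyContinuousOnInterval_intervalIntegral (c := a) (by simp)
      rw [e]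
      refine AbsolutelyContinuousOnInterval.add ?_ h1
      exact (LipschitzWith.const (f a)).lipschitzOnWith.absolutelyContinuousOnInterval
    · filter_upwards [hf.ae_hasDerivAt] with x hx
      exact Complex.reCLM.hasFDerivAt.comp_hasDerivAt x hx
  have bd : ∀ {f f' : ℝ → ℂ}, IsH1 f f' → ∀ {g : ℝ → ℂ}, MemLp g 2 volume →
      MemLp (fun x => f x * g x) 2 volume := by
    intro f f' hf g hg
    obtain ⟨C, hC⟩ := hf.exists_bound
    refine (hg.const_mul (C : ℂ)).of_le (hf.continuous.aestronglyMeasurable.mul hg.1)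
      (Eventually.of_forall fun x => ?_)
    rw [norm_mul, norm_mul, Complex.norm_real]
    exact mul_le_mul_of_nonneg_right ((hC x).trans (le_abs_self C)) (norm_nonneg _)
  obtain ⟨cf, mf, af, df⟩ := key hf
  obtain ⟨cg, mg, ag, dg⟩ := key hg
  refine ⟨by fun_prop, ?_, ?_, fun a b => ?_⟩
  · simpa using bd hf hg.memLp
  · refine ((bd hg hf.memLp_deriv).add (bd hf hg.memLp_deriv)).ae_eq
      (Eventually.of_forall fun x => ?_)
    simp [mul_comm]
  -- Both factors are primitives of locally integrable functions, hence absolutely continuous, and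
  -- integration by parts applies.
  · rw [intervalIntegral.integral_ofReal, ← Complex.ofReal_sub,
      ← (af a b).integral_deriv_mul_eq_sub (ag a b)]
    congr 1
    refine intervalIntegral.integral_congr_ae ?_
    filter_upwards [df, dg] with x h1 h2 _
    rw [h1.deriv, h2.deriv]

/-! ### Holomorphic functions in the lower half-plane -/

/-- Cauchy's theorem in the lower half-plane for functions decaying quadratically. -/
theorem integral_eq_zero_of_quadratic_decay {g : ℂ → ℂ} {M : ℝ}
    (hc : ContinuousOn g {z | z.im ≤ 0}) (hd : DifferentiableOn ℂ g {z | z.im < 0})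
    (hM : ∀ z : ℂ, z.im ≤ 0 → ‖g z‖ * ‖z‖ ^ 2 ≤ M) (hi : Integrable (fun x : ℝ => g x)) :
    ∫ x : ℝ, g x = 0 := by
  have hM0 : 0 ≤ M := (by positivity : (0 : ℝ) ≤ ‖g 0‖ * ‖(0 : ℂ)‖ ^ 2).trans (hM 0 (by simp))
  have bound : ∀ R : ℝ, 0 < R → ∀ z : ℂ, z.im ≤ 0 → R ≤ ‖z‖ → ‖g z‖ ≤ M / R ^ 2 := by
    intro R hR z hz hRz
    rw [le_div_iff₀ (by positivity)]
    refine le_trans ?_ (hM z hz)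
    gcongr
  -- Cauchy on the rectangle [-R, R] × [-R, 0]. The three sides off the real axis have total length
  -- 4R and lie in |z| ≥ R, where |g| ≤ M/R².
  have key : ∀ R : ℝ, 0 < R → ‖∫ x in (-R)..R, g x‖ ≤ 4 * M / R := by
    intro R hR
    have h := Complex.integral_boundary_rect_eq_zero_of_continuousOn_of_differentiableOn g
      (⟨-R, -R⟩ : ℂ) (⟨R, 0⟩ : ℂ) (hc.mono ?_) (hd.mono ?_)
    · simp only [Complex.ofReal_zero, zero_mul, add_zero] at h
      have b1 : ‖∫ x in (-R)..R, g (x + (-R : ℝ) * Complex.I)‖ ≤ M / R ^ 2 * |R - -R| := by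
        refine intervalIntegral.norm_integral_le_of_norm_le_const fun x _ => bound R hR _ ?_ ?_
        · simp [hR.le]
        · refine le_trans ?_ (Complex.abs_im_le_norm _)
          simp [le_abs_self]
      have b2 : ‖∫ y in (-R)..0, g ((R : ℝ) + y * Complex.I)‖ ≤ M / R ^ 2 * |0 - -R| := by
        refine intervalIntegral.norm_integral_le_of_norm_le_const fun y hy => bound R hR _ ?_ ?_
        · rw [Set.uIoc_of_le (by linarith)] at hy
          simpa using hy.2
        · refine le_trans ?_ (Complex.abs_re_le_norm _)
          simp [le_abs_self]
      have b3 : ‖∫ y in (-R)..0, g ((-R : ℝ) + y * Complex.I)‖ ≤ M / R ^ 2 * |0 - -R| := by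
        refine intervalIntegral.norm_integral_le_of_norm_le_const fun y hy => bound R hR _ ?_ ?_
        · rw [Set.uIoc_of_le (by linarith)] at hy
          simpa using hy.2
        · refine le_trans ?_ (Complex.abs_re_le_norm _)
          simp [le_abs_self]
      have e : ∫ x in (-R)..R, g x = (∫ x in (-R)..R, g (x + (-R : ℝ) * Complex.I)) +
          Complex.I • (∫ y in (-R)..0, g ((R : ℝ) + y * Complex.I)) -
          Complex.I • (∫ y in (-R)..0, g ((-R : ℝ) + y * Complex.I)) := by
        linear_combination -h
      rw [e]
      refine (norm_sub_le _ _).trans ?_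
      refine (add_le_add_left (norm_add_le _ _) _).trans ?_
      rw [norm_smul, norm_smul, Complex.norm_I, one_mul, one_mul]
      rw [abs_of_pos (by linarith)] at b1 b2 b3
      refine (add_le_add (add_le_add b1 b2) b3).trans (le_of_eq ?_)
      field_simp
      ring
    · intro z hz
      have := hz.2
      simp only [Set.mem_preimage] at this
      rw [Set.uIcc_of_le (by linarith)] at this
      exact this.2
    · intro z hz
      have := hz.2
      simp only [Set.mem_preimage] at this
      rw [max_eq_right (by linarith)] at this
      exact this.2
  have h1 : Tendsto (fun R : ℝ => ∫ x in (-R)..R, g x) atTop (𝓝 (∫ x : ℝ, g x)) :=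
    intervalIntegral_tendsto_integral hi tendsto_neg_atTop_atBot tendsto_id
  have h2 : Tendsto (fun R : ℝ => ∫ x in (-R)..R, g x) atTop (𝓝 0) := by
    refine squeeze_zero_norm' ?_ (tendsto_const_nhds.div_atTop tendsto_id : Tendsto
      (fun R : ℝ => 4 * M / R) atTop (𝓝 0))
    filter_upwards [eventually_gt_atTop 0] with R hR using key R hR
  exact tendsto_nhds_unique h1 h2

theorem norm_one_add_mul_I_ge {ε : ℝ} (hε : 0 < ε) {z : ℂ} (hz : z.im ≤ 0) :
    ε * ‖z‖ ≤ ‖1 + Complex.I * ε * z‖ ∧ 1 ≤ ‖1 + Complex.I * ε * z‖ := by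
  have e : ‖1 + Complex.I * ε * z‖ ^ 2 = (1 - ε * z.im) ^ 2 + (ε * z.re) ^ 2 := by
    rw [← Complex.normSq_eq_norm_sq, Complex.normSq_apply]
    simp
    ring
  have e' : ‖z‖ ^ 2 = z.re ^ 2 + z.im ^ 2 := by
    rw [← Complex.normSq_eq_norm_sq, Complex.normSq_apply]
    ring
  have h0 : 0 ≤ -(ε * z.im) := by nlinarith
  constructor
  · refine le_of_sq_le_sq ?_ (norm_nonneg _)
    rw [e, mul_pow, e']
    nlinarith
  · refine le_of_sq_le_sq ?_ (norm_nonneg _)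
    rw [e]
    nlinarith [sq_nonneg (ε * z.re)]

/-- Let g be the positive-frequency part of f. It is orthogonal to each regularized function, hence
to f in the limit ε → 0 by dominated convergence; but ⟨g, f⟩ = ‖g‖². -/
theorem hasNegSpectrum_of_forall_pos {f : ℝ → ℂ} (hf : MemLp f 2 volume)
    (h : ∀ ε : ℝ, 0 < ε → HasNegSpectrum fun x => f x / (1 + Complex.I * ε * x) ^ 2) :
    HasNegSpectrum f := by
  obtain ⟨F, hF⟩ := IsFT.exists_of_memLp hf
  refine ⟨F, hF, ?_⟩
  have hG : MemLp ((Set.Ioi (0 : ℝ)).indicator F) 2 volume := hF.memLp_ft.indicator measurableSet_Ioi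
  obtain ⟨g, hg⟩ := IsFT.exists_of_memLp_ft hG
  have h1 : ∀ ε : ℝ, 0 < ε → ∫ x, star (g x) * (f x / (1 + Complex.I * ε * x) ^ 2) = 0 := by
    intro ε hε
    obtain ⟨K, hK, h0⟩ := h ε hε
    rw [hg.integral_star_mul hK, ← integral_zero ℝ ℂ]
    refine integral_congr_ae ?_
    filter_upwards [h0] with ξ hξ
    by_cases hx : 0 < ξ
    · simp [hξ hx]
    · simp [hx]
  have h2 : Tendsto (fun ε : ℝ => ∫ x, star (g x) * (f x / (1 + Complex.I * ε * x) ^ 2))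
      (𝓝[>] 0) (𝓝 (∫ x, star (g x) * f x)) := by
    refine tendsto_integral_filter_of_dominated_convergence (fun x => ‖g x‖ * ‖f x‖) ?_ ?_ ?_ ?_
    · refine Eventually.of_forall fun ε => ?_
      refine hg.memLp.star.1.mul (hf.1.aemeasurable.div ?_).aestronglyMeasurable
      exact Continuous.aemeasurable (by fun_prop)
    · filter_upwards [self_mem_nhdsWithin] with ε hε
      refine Eventually.of_forall fun x => ?_
      rw [norm_mul, norm_star, norm_div, norm_pow]
      have := (norm_one_add_mul_I_ge hε (z := (x : ℂ)) (by simp)).2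
      gcongr
      exact div_le_self (norm_nonneg _) (one_le_pow₀ this)
    · exact hg.memLp.norm.integrable_mul hf.norm
    · refine Eventually.of_forall fun x => ?_
      have hc : ContinuousAt (fun ε : ℝ => star (g x) * (f x / (1 + Complex.I * ε * x) ^ 2)) 0 := by
        refine ContinuousAt.mul continuousAt_const (ContinuousAt.div continuousAt_const ?_ (by simp))
        exact Continuous.continuousAt (by fun_prop)
      have := hc.tendsto.mono_left (nhdsWithin_le_nhds (s := Set.Ioi 0))
      simpa using this
  have h3 : ∫ x, star (g x) * f x = 0 := by
    refine tendsto_nhds_unique h2 (tendsto_const_nhds.congr' ?_)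
    filter_upwards [self_mem_nhdsWithin] with ε hε
    exact (h1 ε hε).symm
  rw [hg.integral_star_mul hF] at h3
  have h4 : ∫ ξ, star ((Set.Ioi (0 : ℝ)).indicator F ξ) * F ξ
      = ((∫ ξ, ‖(Set.Ioi (0 : ℝ)).indicator F ξ‖ ^ 2 : ℝ) : ℂ) := by
    refine Eq.trans ?_ (integral_ofReal (𝕜 := ℂ))
    refine integral_congr_ae (Eventually.of_forall fun ξ => ?_)
    by_cases hx : 0 < ξ
    · simp [hx, Complex.conj_mul']
    · simp [hx]
  rw [h4] at h3
  have h5 : ∫ ξ, ‖(Set.Ioi (0 : ℝ)).indicator F ξ‖ ^ 2 = 0 := by exact_mod_cast h3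
  rw [integral_eq_zero_iff_of_nonneg (fun _ => by positivity)
    ((memLp_two_iff_integrable_sq_norm hG.1).1 hG)] at h5
  filter_upwards [h5] with ξ hξ hpos
  simpa [hpos] using hξ

/-- The boundary values of a bounded holomorphic function in the lower half-plane have nonpositive
frequencies. -/
theorem hasNegSpectrum_of_differentiableOn {f : ℂ → ℂ} {C : ℝ}
    (hc : ContinuousOn f {z | z.im ≤ 0}) (hd : DifferentiableOn ℂ f {z | z.im < 0})
    (hC : ∀ z : ℂ, z.im ≤ 0 → ‖f z‖ ≤ C) (hm : MemLp (fun x : ℝ => f x) 2 volume) :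
    HasNegSpectrum fun x : ℝ => f x := by
  -- The factor (1 + iεz)⁻² supplies the quadratic decay, and its only pole i/ε is in the upper
  -- half-plane.
  refine hasNegSpectrum_of_forall_pos hm fun ε hε => ?_
  have hne : ∀ z : ℂ, z.im ≤ 0 → (1 + Complex.I * ε * z) ≠ 0 := fun z hz h => by
    have := (norm_one_add_mul_I_ge hε hz).2
    rw [h, norm_zero] at this
    linarith
  have hcr : Continuous (fun x : ℝ => f x) :=
    hc.comp_continuous Complex.continuous_ofReal (fun x => by simp)
  have hk : MemLp (fun x : ℝ => ((1 + Complex.I * ε * x) ^ 2)⁻¹) 2 volume := by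
    have hcont : Continuous (fun x : ℝ => ((1 + Complex.I * ε * x) ^ 2)⁻¹) :=
      Continuous.inv₀ (by fun_prop) (fun x => pow_ne_zero _ (hne x (by simp)))
    have h1 : MemLp (fun x : ℝ => (1 + ((ε * x : ℝ) : ℂ) * Complex.I)⁻¹) 2 volume := by
      have h := (memLp_two_iff_integrable_sq_norm memLp_two_inv_one_add_mul_I.1).1
        memLp_two_inv_one_add_mul_I
      refine (memLp_two_iff_integrable_sq_norm ?_).2 (h.comp_mul_left' hε.ne')
      refine (Continuous.inv₀ (by fun_prop) fun x h => ?_).aestronglyMeasurable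
      refine hne x (by simp) ?_
      rw [← h]; push_cast; ring
    refine h1.of_le hcont.aestronglyMeasurable (Eventually.of_forall fun x => ?_)
    have h2 : (1 + ((ε * x : ℝ) : ℂ) * Complex.I) = 1 + Complex.I * ε * x := by push_cast; ring
    have h3 := (norm_one_add_mul_I_ge hε (z := (x : ℂ)) (by simp)).2
    rw [h2, norm_inv, norm_inv, norm_pow]
    gcongr
    nlinarith
  have hm' : MemLp (fun x : ℝ => f x / (1 + Complex.I * ε * x) ^ 2) 2 volume := by
    refine (hk.const_mul (C : ℂ)).of_le (hcr.aestronglyMeasurable.mul hk.1)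
      (Eventually.of_forall fun x => ?_)
    rw [norm_mul, div_eq_mul_inv, norm_mul, Complex.norm_real]
    gcongr
    exact (hC x (by simp)).trans (le_abs_self C)
  have hi : Integrable (fun x : ℝ => f x / (1 + Complex.I * ε * x) ^ 2) := hm.integrable_mul hk
  refine ⟨_, IsFT.of_integrable hm' hi, Eventually.of_forall fun ξ hξ => ?_⟩
  rw [Real.fourier_real_eq_integral_exp_smul]
  -- For a positive frequency ξ the character is bounded in the lower half-plane, so Cauchy's
  -- theorem makes the Fourier integral vanish.
  have hexp : ∀ z : ℂ, z.im ≤ 0 → ‖Complex.exp (-2 * Real.pi * ξ * Complex.I * z)‖ ≤ 1 := by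
    intro z hz
    rw [Complex.norm_exp, Real.exp_le_one_iff]
    have : (-2 * Real.pi * ξ * Complex.I * z : ℂ).re = (2 * Real.pi * ξ) * z.im := by simp
    rw [this]
    exact mul_nonpos_of_nonneg_of_nonpos (by positivity) hz
  have key := integral_eq_zero_of_quadratic_decay (M := C / ε ^ 2)
    (g := fun z => Complex.exp (-2 * Real.pi * ξ * Complex.I * z) *
      (f z / (1 + Complex.I * ε * z) ^ 2)) ?_ ?_ ?_ ?_
  · refine Eq.trans ?_ key
    refine integral_congr_ae (Eventually.of_forall fun x => ?_)
    simp only [smul_eq_mul]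
    congr 2
    push_cast
    ring
  · refine ContinuousOn.mul (by fun_prop) (hc.div (by fun_prop) fun z hz => ?_)
    exact pow_ne_zero _ (hne z hz)
  · refine DifferentiableOn.mul (by fun_prop) (hd.div (by fun_prop) fun z hz => ?_)
    exact pow_ne_zero _ (hne z (le_of_lt hz))
  · intro z hz
    have h1 := norm_one_add_mul_I_ge hε hz
    rw [norm_mul, norm_div, norm_pow]
    have h3 : 0 < ‖1 + Complex.I * ε * z‖ := by linarith
    have h2 : ‖f z‖ / ‖1 + Complex.I * ε * z‖ ^ 2 * ‖z‖ ^ 2 ≤ C / ε ^ 2 := by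
      rw [div_mul_eq_mul_div, div_le_div_iff₀ (by positivity) (by positivity), mul_assoc,
        ← mul_pow, mul_comm ‖z‖]
      gcongr
      · exact (norm_nonneg _).trans (hC z hz)
      · exact hC z hz
      · exact h1.1
    rw [mul_assoc]
    exact (mul_le_of_le_one_left (by positivity) (hexp z hz)).trans h2
  · refine hi.bdd_mul (c := 1) (Continuous.aestronglyMeasurable (by fun_prop))
      (Eventually.of_forall fun x => hexp x (by simp))

/-! ### Fourier-Laplace transforms and a lower bound by compactness. -/

/-- The Fourier-Laplace transform of `h`, holomorphic in the lower half-plane when `h` is integrable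
and supported in the negative half-line. -/
def lowerLaplace (h : ℝ → ℂ) (z : ℂ) : ℂ :=
  ∫ ξ : ℝ, Complex.exp (2 * Real.pi * Complex.I * ξ * z) * h ξ

section LowerLaplace

variable {h : ℝ → ℂ}

theorem lowerLaplace_ofReal (h : ℝ → ℂ) (x : ℝ) : lowerLaplace h x = 𝓕⁻ h x := by
  rw [Real.fourierInv_eq', lowerLaplace]
  refine integral_congr_ae (Eventually.of_forall fun ξ => ?_)
  simp only [smul_eq_mul]
  congr 2
  simp
  ring

theorem norm_exp_mul_le (hs : ∀ ξ, 0 ≤ ξ → h ξ = 0) {z : ℂ} (hz : z.im ≤ 0) (ξ : ℝ) :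
    ‖Complex.exp (2 * Real.pi * Complex.I * ξ * z) * h ξ‖ ≤ ‖h ξ‖ := by
  rcases le_or_gt 0 ξ with hξ | hξ
  · simp [hs ξ hξ]
  · rw [norm_mul]
    refine mul_le_of_le_one_left (norm_nonneg _) ?_
    rw [Complex.norm_exp, Real.exp_le_one_iff]
    have : (2 * Real.pi * Complex.I * ξ * z : ℂ).re = 2 * Real.pi * (-(ξ * z.im)) := by
      simp; ring
    rw [this]
    have h1 : 0 ≤ ξ * z.im := mul_nonneg_of_nonpos_of_nonpos hξ.le hz
    have := Real.pi_pos
    nlinarith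

theorem aestronglyMeasurable_exp_mul (hi : Integrable h) (z : ℂ) :
    AEStronglyMeasurable (fun ξ : ℝ => Complex.exp (2 * Real.pi * Complex.I * ξ * z) * h ξ)
      volume :=
  AEStronglyMeasurable.mul (Continuous.aestronglyMeasurable (by fun_prop)) hi.1

theorem continuousOn_lowerLaplace (hi : Integrable h) (hs : ∀ ξ, 0 ≤ ξ → h ξ = 0) :
    ContinuousOn (lowerLaplace h) {z | z.im ≤ 0} := by
  refine continuousOn_of_dominated (bound := fun ξ => ‖h ξ‖)
    (fun z _ => aestronglyMeasurable_exp_mul hi z)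
    (fun z hz => Eventually.of_forall fun ξ => norm_exp_mul_le hs hz ξ) hi.norm
    (Eventually.of_forall fun ξ => ?_)
  fun_prop

theorem norm_lowerLaplace_le (hi : Integrable h) (hs : ∀ ξ, 0 ≤ ξ → h ξ = 0) {z : ℂ}
    (hz : z.im ≤ 0) : ‖lowerLaplace h z‖ ≤ ∫ ξ, ‖h ξ‖ :=
  norm_integral_le_of_norm_le hi.norm (Eventually.of_forall fun ξ => norm_exp_mul_le hs hz ξ)

theorem hasDerivAt_lowerLaplace (hi : Integrable h) (hs : ∀ ξ, 0 ≤ ξ → h ξ = 0)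
    (hi' : Integrable fun ξ : ℝ => 2 * Real.pi * Complex.I * ξ * h ξ) {z : ℂ} (hz : z.im < 0) :
    HasDerivAt (lowerLaplace h)
      (lowerLaplace (fun ξ : ℝ => 2 * Real.pi * Complex.I * ξ * h ξ) z) z := by
  have ho : IsOpen {z : ℂ | z.im < 0} := isOpen_lt Complex.continuous_im continuous_const
  have hs' : ∀ ξ : ℝ, 0 ≤ ξ → 2 * Real.pi * Complex.I * ξ * h ξ = 0 := fun ξ hξ => by
    rw [hs ξ hξ, mul_zero]
  refine (hasDerivAt_integral_of_dominated_loc_of_deriv_le (ho.mem_nhds hz)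
    (bound := fun ξ : ℝ => ‖2 * Real.pi * Complex.I * ξ * h ξ‖)
    (F := fun (w : ℂ) (ξ : ℝ) => Complex.exp (2 * Real.pi * Complex.I * ξ * w) * h ξ)
    (Eventually.of_forall fun w => aestronglyMeasurable_exp_mul hi w) ?_
    (aestronglyMeasurable_exp_mul hi' z)
    (Eventually.of_forall fun ξ w hw => norm_exp_mul_le hs' (le_of_lt hw) ξ) hi'.norm
    (Eventually.of_forall fun ξ w _ => ?_)).2
  · exact hi.norm.mono' (aestronglyMeasurable_exp_mul hi z)
      (Eventually.of_forall fun ξ => norm_exp_mul_le hs hz.le ξ)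
  · have h1 : HasDerivAt (fun w : ℂ => 2 * Real.pi * Complex.I * ξ * w)
        (2 * Real.pi * Complex.I * ξ) w := by
      simpa using (hasDerivAt_id w).const_mul (2 * Real.pi * Complex.I * ξ : ℂ)
    convert! h1.cexp.mul_const (h ξ) using 1
    ring

/-- The transform in the coordinates `z = x + i log t`, which extend to `t = 0`. -/
def polarLaplace (h : ℝ → ℂ) (p : ℝ × ℝ) : ℂ :=
  ∫ ξ : ℝ, ((p.1 ^ (-2 * Real.pi * ξ) : ℝ) : ℂ) *
    (Complex.exp (2 * Real.pi * Complex.I * ξ * p.2) * h ξ)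

theorem lowerLaplace_eq_polarLaplace (h : ℝ → ℂ) (z : ℂ) :
    lowerLaplace h z = polarLaplace h (Real.exp z.im, z.re) := by
  refine integral_congr_ae (Eventually.of_forall fun ξ => ?_)
  simp only [← mul_assoc]
  congr 1
  rw [← Real.exp_mul, Complex.ofReal_exp, ← Complex.exp_add]
  congr 1
  conv_lhs => rw [← Complex.re_add_im z]
  push_cast
  linear_combination (2 * Real.pi * ξ * z.im) * Complex.I_mul_I

theorem continuous_rpow_mul_exp_mul (hs : ∀ ξ, 0 ≤ ξ → h ξ = 0) (ξ : ℝ) :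
    Continuous fun p : ℝ × ℝ => ((p.1 ^ (-2 * Real.pi * ξ) : ℝ) : ℂ) *
      (Complex.exp (2 * Real.pi * Complex.I * ξ * p.2) * h ξ) := by
  rcases le_or_gt 0 ξ with hξ | hξ
  · simp only [hs ξ hξ, mul_zero]
    exact continuous_const
  · have h1 : Continuous fun t : ℝ => t ^ (-2 * Real.pi * ξ) :=
      Real.continuous_rpow_const (by have := Real.pi_pos; nlinarith)
    fun_prop

theorem norm_rpow_mul_exp_mul_le (hs : ∀ ξ, 0 ≤ ξ → h ξ = 0) {t : ℝ} (ht : t ∈ Set.Icc (0 : ℝ) 1)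
    (x ξ : ℝ) : ‖((t ^ (-2 * Real.pi * ξ) : ℝ) : ℂ) *
      (Complex.exp (2 * Real.pi * Complex.I * ξ * x) * h ξ)‖ ≤ ‖h ξ‖ := by
  rcases le_or_gt 0 ξ with hξ | hξ
  · simp [hs ξ hξ]
  · rw [norm_mul]
    refine (mul_le_of_le_one_left (norm_nonneg _) ?_).trans
      (norm_exp_mul_le hs (z := (x : ℂ)) (by simp) ξ)
    rw [Complex.norm_real, Real.norm_of_nonneg (Real.rpow_nonneg ht.1 _)]
    exact Real.rpow_le_one ht.1 ht.2 (by have := Real.pi_pos; nlinarith)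

theorem aestronglyMeasurable_rpow_mul_exp_mul (hi : Integrable h) (p : ℝ × ℝ) :
    AEStronglyMeasurable (fun ξ : ℝ => ((p.1 ^ (-2 * Real.pi * ξ) : ℝ) : ℂ) *
      (Complex.exp (2 * Real.pi * Complex.I * ξ * p.2) * h ξ)) volume := by
  refine AEStronglyMeasurable.mul (Measurable.aestronglyMeasurable ?_)
    (aestronglyMeasurable_exp_mul hi _)
  exact Complex.measurable_ofReal.comp (by fun_prop)

theorem continuousOn_polarLaplace (hi : Integrable h) (hs : ∀ ξ, 0 ≤ ξ → h ξ = 0) :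
    ContinuousOn (polarLaplace h) (Set.Icc 0 1 ×ˢ Set.univ) :=
  continuousOn_of_dominated (bound := fun ξ => ‖h ξ‖)
    (fun p _ => aestronglyMeasurable_rpow_mul_exp_mul hi p)
    (fun p hp => Eventually.of_forall fun ξ => norm_rpow_mul_exp_mul_le hs hp.1 p.2 ξ) hi.norm
    (Eventually.of_forall fun ξ => (continuous_rpow_mul_exp_mul hs ξ).continuousOn)

/-- The boundary t = 0 stands for Im z = -∞. It matters that `h` vanishes at ξ = 0 as well, since
there the power is 0^0 = 1. -/
theorem polarLaplace_zero (hs : ∀ ξ, 0 ≤ ξ → h ξ = 0) (x : ℝ) : polarLaplace h (0, x) = 0 := by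
  rw [polarLaplace, ← integral_zero ℝ ℂ]
  refine integral_congr_ae (Eventually.of_forall fun ξ => ?_)
  rcases le_or_gt 0 ξ with hξ | hξ
  · simp [hs ξ hξ]
  · have : -2 * Real.pi * ξ ≠ 0 := by simp [Real.pi_ne_zero, hξ.ne]
    simp only [Real.zero_rpow this]
    simp

/-- The Riemann-Lebesgue lemma, uniform in the depth. The densities depend continuously on t in L¹,
so near each t₀ they move by less than 1/4 in norm; Riemann-Lebesgue at t₀ gives the other 1/4, and
compactness of [0, 1] does the rest. -/
theorem eventually_forall_norm_polarLaplace_lt (hi : Integrable h) (hs : ∀ ξ, 0 ≤ ξ → h ξ = 0) :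
    ∀ᶠ x in cocompact ℝ, ∀ t ∈ Set.Icc (0 : ℝ) 1, ‖polarLaplace h (t, x)‖ < 1 / 2 := by
  refine isCompact_Icc.induction_on
    (p := fun s => ∀ᶠ x in cocompact ℝ, ∀ t ∈ s, ‖polarLaplace h (t, x)‖ < 1 / 2)
    (by simp) (fun s t hst ht => ht.mono fun x hx y hy => hx y (hst hy))
    (fun s t h1 h2 => ?_) (fun t₀ ht₀ => ?_)
  · filter_upwards [h1, h2] with x hx1 hx2 y hy
    exact hy.elim (hx1 y) (hx2 y)
  set k : ℝ → ℝ → ℂ := fun t ξ => ((t ^ (-2 * Real.pi * ξ) : ℝ) : ℂ) * h ξ with hk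
  have hkb : ∀ t ∈ Set.Icc (0 : ℝ) 1, ∀ ξ, ‖k t ξ‖ ≤ ‖h ξ‖ := by
    intro t ht ξ
    simpa [hk] using norm_rpow_mul_exp_mul_le hs ht 0 ξ
  have hkm : ∀ t, AEStronglyMeasurable (k t) volume := fun t => by
    simpa [hk] using aestronglyMeasurable_rpow_mul_exp_mul hi (t, 0)
  have hki : ∀ t ∈ Set.Icc (0 : ℝ) 1, Integrable (k t) := fun t ht =>
    hi.norm.mono' (hkm t) (Eventually.of_forall (hkb t ht))
  have hkx : ∀ t x, polarLaplace h (t, x) = 𝓕⁻ (k t) x := by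
    intro t x
    rw [← lowerLaplace_ofReal]
    refine integral_congr_ae (Eventually.of_forall fun ξ => ?_)
    simp only [hk]
    ring
  have hD : Tendsto (fun t => ∫ ξ, ‖k t ξ - k t₀ ξ‖) (𝓝[Set.Icc 0 1] t₀) (𝓝 0) := by
    rw [show 𝓝 (0 : ℝ) = 𝓝 (∫ ξ : ℝ, ‖k t₀ ξ - k t₀ ξ‖) by simp]
    refine tendsto_integral_filter_of_dominated_convergence (fun ξ => 2 * ‖h ξ‖)
      (Eventually.of_forall fun t => ((hkm t).sub (hkm t₀)).norm) ?_ (hi.norm.const_mul 2)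
      (Eventually.of_forall fun ξ => ?_)
    · filter_upwards [self_mem_nhdsWithin] with t ht
      refine Eventually.of_forall fun ξ => ?_
      rw [norm_norm, two_mul]
      exact (norm_sub_le _ _).trans (add_le_add (hkb t ht ξ) (hkb t₀ ht₀ ξ))
    · have hc : Continuous fun t => k t ξ := by
        have := (continuous_rpow_mul_exp_mul hs ξ).comp (Continuous.prodMk_left (0 : ℝ))
        simpa [hk, Function.comp_def] using this
      exact ((hc.sub continuous_const).norm.tendsto t₀).mono_left nhdsWithin_le_nhds
  refine ⟨{t | t ∈ Set.Icc (0 : ℝ) 1 ∧ ∫ ξ, ‖k t ξ - k t₀ ξ‖ < 1 / 4}, ?_, ?_⟩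
  · filter_upwards [self_mem_nhdsWithin, hD.eventually (gt_mem_nhds (by norm_num : (0 : ℝ) < 1 / 4))]
      with t h1 h2 using ⟨h1, h2⟩
  · have hRL : Tendsto (𝓕⁻ (k t₀)) (cocompact ℝ) (𝓝 0) := by
      have e : 𝓕⁻ (k t₀) = fun x => 𝓕 (k t₀) (-x) :=
        funext fun x => Real.fourierInv_eq_fourier_neg _ _
      rw [e]
      exact (Real.zero_at_infty_fourier (k t₀)).comp
        (Homeomorph.neg ℝ).isClosedEmbedding.tendsto_cocompact
    have hRL' : ∀ᶠ x in cocompact ℝ, ‖𝓕⁻ (k t₀) x‖ < 1 / 4 := by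
      have := hRL.norm
      rw [norm_zero] at this
      exact this.eventually (gt_mem_nhds (by norm_num))
    filter_upwards [hRL'] with x hx t ht
    have h1 : polarLaplace h (t, x) - 𝓕⁻ (k t₀) x = 𝓕⁻ (fun ξ => k t ξ - k t₀ ξ) x := by
      rw [hkx, Real.fourierInv_eq, Real.fourierInv_eq, Real.fourierInv_eq, ← integral_sub]
      · refine integral_congr_ae (Eventually.of_forall fun ξ => ?_)
        simp only [smul_sub]
      · have := (Real.fourierIntegral_convergent_iff (-x)).2 (hki t ht.1)
        simpa using this
      · have := (Real.fourierIntegral_convergent_iff (-x)).2 (hki t₀ ht₀)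
        simpa using this
    have h2 : ‖𝓕⁻ (fun ξ => k t ξ - k t₀ ξ) x‖ ≤ ∫ ξ, ‖k t ξ - k t₀ ξ‖ := by
      rw [Real.fourierInv_eq_fourier_neg]
      exact VectorFourier.norm_fourierIntegral_le_integral_norm _ _ _ _ _
    have h3 : polarLaplace h (t, x)
        = (polarLaplace h (t, x) - 𝓕⁻ (k t₀) x) + 𝓕⁻ (k t₀) x := by ring
    rw [h3, h1]
    refine (norm_add_le _ _).trans_lt ?_
    have := ht.2
    linarith

/-- If `1 + L h` has no zero in the closed lower half-plane, it is bounded away from zero there. -/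
theorem exists_le_norm_one_add_lowerLaplace (hi : Integrable h) (hs : ∀ ξ, 0 ≤ ξ → h ξ = 0)
    (hne : ∀ z : ℂ, z.im ≤ 0 → 1 + lowerLaplace h z ≠ 0) :
    ∃ δ > 0, ∀ z : ℂ, z.im ≤ 0 → δ ≤ ‖1 + lowerLaplace h z‖ := by
  obtain ⟨K, hK, hKx⟩ := mem_cocompact.1 (eventually_forall_norm_polarLaplace_lt hi hs)
  have hne' : ∀ p ∈ Set.Icc (0 : ℝ) 1 ×ˢ K, 1 + polarLaplace h p ≠ 0 := by
    rintro ⟨t, x⟩ ⟨ht, -⟩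
    -- At t = 0 the value is 1; for t > 0 it is the value at the point x + i log t of the closed
    -- half-plane.
    rcases ht.1.eq_or_lt with h0 | h0
    · simp only at h0
      rw [← h0, polarLaplace_zero hs]
      simp
    · have := hne ⟨x, Real.log t⟩ (Real.log_nonpos ht.1 ht.2)
      rw [lowerLaplace_eq_polarLaplace] at this
      simpa [Real.exp_log h0] using this
  have hc : ContinuousOn (fun p => ‖1 + polarLaplace h p‖) (Set.Icc (0 : ℝ) 1 ×ˢ K) :=
    (continuousOn_const.add ((continuousOn_polarLaplace hi hs).mono
      (Set.prod_mono_right (Set.subset_univ _)))).norm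
  obtain ⟨δ, hδ, hδ'⟩ : ∃ δ > 0, ∀ p ∈ Set.Icc (0 : ℝ) 1 ×ˢ K, δ ≤ ‖1 + polarLaplace h p‖ := by
    rcases (Set.Icc (0 : ℝ) 1 ×ˢ K).eq_empty_or_nonempty with he | he
    · exact ⟨1, one_pos, by simp [he]⟩
    · obtain ⟨p, hp, hmin⟩ := (isCompact_Icc.prod hK).exists_isMinOn he hc
      exact ⟨_, norm_pos_iff.2 (hne' p hp), fun q hq => hmin hq⟩
  refine ⟨min δ (1 / 2), by positivity, fun z hz => ?_⟩
  rw [lowerLaplace_eq_polarLaplace]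
  have ht : Real.exp z.im ∈ Set.Icc (0 : ℝ) 1 := ⟨(Real.exp_pos _).le, Real.exp_le_one_iff.2 hz⟩
  by_cases hx : z.re ∈ K
  · exact (min_le_left _ _).trans (hδ' _ ⟨ht, hx⟩)
  · refine (min_le_right _ _).trans ?_
    have h1 := hKx hx _ ht
    have h2 := norm_sub_le_norm_add (1 : ℂ) (polarLaplace h (Real.exp z.im, z.re))
    rw [norm_one] at h2
    linarith

end LowerLaplace

/-! ### The Cauchy integral and the quotient w'/(1 + w'). -/

/-- The kernel 1/(2πi(z - s)) is the Fourier transform of exp(2πizξ) restricted to ξ < 0, so this is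
Plancherel. The factor 2i is the symbol of H + i on negative frequencies. -/
theorem lowerExtension_eq_lowerLaplace {u : ℝ → ℝ} {F : ℝ → ℂ}
    (hF : IsFT (fun x => (u x : ℂ)) F) {z : ℂ} (hz : z.im < 0) :
    lowerExtension u z
      = lowerLaplace (fun ξ => (Set.Iio (0 : ℝ)).indicator (fun ξ => 2 * Complex.I * F ξ) ξ) z := by
  have hpi : (Real.pi : ℂ) ≠ 0 := by exact_mod_cast Real.pi_ne_zero
  have hre : ∀ s : ℝ, 0 < (2 * Real.pi * Complex.I * (z - s)).re := by
    intro s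
    have : (2 * Real.pi * Complex.I * (z - s)).re = 2 * Real.pi * (-z.im) := by simp
    rw [this]
    have := Real.pi_pos
    have : 0 < -z.im := by linarith
    positivity
  set k : ℝ → ℂ := (Set.Iio (0 : ℝ)).indicator
    (fun ξ : ℝ => Complex.exp (2 * Real.pi * Complex.I * z * ξ)) with hk
  have hk1 : Integrable k := by
    rw [hk, integrable_indicator_iff measurableSet_Iio]
    have := integrableOn_exp_mul_complex_Iic (by simpa using hre 0) (0 : ℝ)
      (a := 2 * Real.pi * Complex.I * z)
    exact this.mono_set Set.Iio_subset_Iic_self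
  have hkb : ∀ ξ, ‖k ξ‖ ≤ 1 := by
    intro ξ
    by_cases hξ : ξ < 0
    · simp only [hk, Set.indicator_of_mem (Set.mem_Iio.2 hξ)]
      rw [Complex.norm_exp, Real.exp_le_one_iff]
      have h1 := hre 0
      have h2 : (2 * Real.pi * Complex.I * z * ξ : ℂ).re
          = (2 * Real.pi * Complex.I * (z - (0 : ℝ))).re * ξ := by simp
      rw [h2]
      exact mul_nonpos_of_nonneg_of_nonpos h1.le hξ.le
    · simp [hk, hξ]
  have hk2 : MemLp k 2 volume := by
    refine (memLp_two_iff_integrable_sq_norm hk1.1).2 (hk1.norm.mono' (hk1.1.norm.pow 2)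
      (Eventually.of_forall fun ξ => ?_))
    rw [Real.norm_of_nonneg (by positivity)]
    nlinarith [hkb ξ, norm_nonneg (k ξ)]
  have hfk : ∀ s : ℝ, 𝓕 k s = 1 / (2 * Real.pi * Complex.I * (z - s)) := by
    intro s
    rw [Real.fourier_real_eq_integral_exp_smul]
    have e : ∀ ξ : ℝ, Complex.exp (↑(-2 * Real.pi * ξ * s) * Complex.I) • k ξ
        = (Set.Iio (0 : ℝ)).indicator
          (fun ξ : ℝ => Complex.exp (2 * Real.pi * Complex.I * (z - s) * ξ)) ξ := by
      intro ξ
      by_cases hξ : ξ < 0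
      · simp only [hk, Set.indicator_of_mem (Set.mem_Iio.2 hξ), smul_eq_mul, ← Complex.exp_add]
        congr 1
        push_cast
        ring
      · simp [hk, hξ]
    simp_rw [e]
    rw [integral_indicator measurableSet_Iio, ← integral_Iic_eq_integral_Iio,
      integral_exp_mul_complex_Iic (hre s)]
    simp
  have h1 := hF.reflect.star.integral_star_mul (IsFT.of_integrable hk2 hk1)
  simp only [star_star, neg_neg] at h1
  have h2 : lowerLaplace (fun ξ => (Set.Iio (0 : ℝ)).indicator (fun ξ => 2 * Complex.I * F ξ) ξ) z
      = 2 * Complex.I * ∫ ξ, F ξ * k ξ := by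
    rw [lowerLaplace, ← integral_const_mul]
    refine integral_congr_ae (Eventually.of_forall fun ξ => ?_)
    by_cases hξ : ξ < 0
    · simp only [hk, Set.indicator_of_mem (Set.mem_Iio.2 hξ)]
      rw [mul_right_comm _ (ξ : ℂ) z]
      ring
    · simp [hk, hξ]
  have h3 : ∫ s : ℝ, (u s : ℂ) / (z - s) = 2 * Real.pi * Complex.I * ∫ s, (u s : ℂ) * 𝓕 k s := by
    rw [← integral_const_mul]
    refine integral_congr_ae (Eventually.of_forall fun s => ?_)
    have hzs : z - (s : ℂ) ≠ 0 := fun h => by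
      have := hre s
      rw [h] at this
      simp at this
    simp only [hfk]
    field_simp
  rw [h2, lowerExtension, h3, h1]
  field_simp

/-- This is where conformality enters. Together with the absence of zeros on the line it bounds the
extension of 1 + w' away from zero, so the quotient extends to a bounded holomorphic function. -/
theorem hasNegSpectrum_div_one_add {u : ℝ → ℝ} {u' u'' : ℝ → ℂ}
    (hu : IsH1 (fun x => (u x : ℂ)) u') (hu' : IsH1 u' u'') (hconf : IsConformalProfile u)
    (hne : ∀ x, 1 + (hilbert u' x + Complex.I * u' x) ≠ 0) :
    HasNegSpectrum (fun x => (hilbert u' x + Complex.I * u' x) /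
      (1 + (hilbert u' x + Complex.I * u' x))) ∧
    ∃ δ > 0, ∀ x, δ ≤ ‖1 + (hilbert u' x + Complex.I * u' x)‖ := by
  obtain ⟨F, hF, hFi, -, -⟩ := hu.exists_ft
  set h₀ : ℝ → ℂ := fun ξ => (Set.Iio (0 : ℝ)).indicator (fun ξ => 2 * Complex.I * F ξ) ξ with hh₀
  have hs₀ : ∀ ξ, 0 ≤ ξ → h₀ ξ = 0 := fun ξ hξ => by simp [hh₀, not_lt.2 hξ]
  have hi₀ : Integrable h₀ := (hFi.const_mul _).indicator measurableSet_Iio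
  have hW : IsH1 (fun x => hilbert (fun x => (u x : ℂ)) x + Complex.I * (u x : ℂ))
      (fun x => hilbert u' x + Complex.I * u' x) := hu.hilbert.add (hu.const_mul _)
  have hW' : IsH1 (fun x => hilbert u' x + Complex.I * u' x)
      (fun x => hilbert u'' x + Complex.I * u'' x) := hu'.hilbert.add (hu'.const_mul _)
  have hWF : IsFT (fun x => hilbert (fun x => (u x : ℂ)) x + Complex.I * (u x : ℂ)) h₀ := by
    refine (hF.hilbert.add (hF.const_mul Complex.I)).congr (ae_eq_refl _) ?_
    filter_upwards [Measure.ae_ne volume (0 : ℝ)] with ξ hξ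
    rcases lt_or_gt_of_ne hξ with h | h
    · simp [hh₀, h, Real.sign_of_neg h]; ring
    · simp [hh₀, h.le, Real.sign_of_pos h]
  obtain ⟨F₁, hF₁, hFi₁, hF₁', -⟩ := hW'.exists_ft
  have hae := hW.ft_deriv hWF hF₁
  set h₁ : ℝ → ℂ := fun ξ => 2 * Real.pi * Complex.I * ξ * h₀ ξ with hh₁
  have hi₁ : Integrable h₁ := hFi₁.congr hae
  have hs₁ : ∀ ξ, 0 ≤ ξ → h₁ ξ = 0 := fun ξ hξ => by simp [hh₁, hs₀ ξ hξ]
  have hW₁ : ∀ x : ℝ, lowerLaplace h₁ x = hilbert u' x + Complex.I * u' x := by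
    intro x
    rw [lowerLaplace_ofReal, ← Real.fourierInv_congr_ae hae]
    exact (congrFun hF₁' x).symm
  have ho : IsOpen {z : ℂ | z.im < 0} := isOpen_lt Complex.continuous_im continuous_const
  have hder : ∀ z : ℂ, z.im < 0 → HasDerivAt (lowerLaplace h₀) (lowerLaplace h₁ z) z :=
    fun z hz => hasDerivAt_lowerLaplace hi₀ hs₀ hi₁ hz
  have hnz : ∀ z : ℂ, z.im ≤ 0 → 1 + lowerLaplace h₁ z ≠ 0 := by
    intro z hz
    rcases hz.lt_or_eq with hz' | hz'
    · have h1 : HasDerivAt (fun w => w + lowerExtension u w) (1 + lowerLaplace h₁ z) z := by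
        refine ((hasDerivAt_id z).add (hder z hz')).congr_of_eventuallyEq ?_
        filter_upwards [ho.mem_nhds hz'] with w hw
        simp only [Pi.add_apply, id]
        rw [lowerExtension_eq_lowerLaplace hF hw]
      have h2 := hconf z hz'
      rwa [h1.deriv] at h2
    · have hzr : z = (z.re : ℂ) := Complex.ext rfl (by simp [hz'])
      rw [hzr, hW₁]
      exact hne _
  obtain ⟨δ, hδ, hδ'⟩ := exists_le_norm_one_add_lowerLaplace hi₁ hs₁ hnz
  refine ⟨?_, δ, hδ, fun x => by simpa [hW₁] using hδ' x (by simp)⟩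
  -- Differentiating under the integral again would require ξ h₁ to be integrable, which is not
  -- available; instead L h₁ is holomorphic as the derivative of L h₀.
  have hd : DifferentiableOn ℂ (lowerLaplace h₁) {z | z.im < 0} := by
    have h1 : DifferentiableOn ℂ (lowerLaplace h₀) {z | z.im < 0} :=
      fun z hz => (hder z hz).differentiableAt.differentiableWithinAt
    exact (h1.deriv ho).congr fun z hz => (hder z hz).deriv.symm
  have hc := continuousOn_lowerLaplace hi₁ hs₁
  have key := hasNegSpectrum_of_differentiableOn (C := (∫ ξ, ‖h₁ ξ‖) / δ)
    (f := fun z => lowerLaplace h₁ z / (1 + lowerLaplace h₁ z))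
    (hc.div (continuousOn_const.add hc) hnz)
    (hd.div ((differentiableOn_const _).add hd) fun z hz => hnz z (le_of_lt hz)) ?_ ?_
  · simpa only [hW₁] using key
  · intro z hz
    rw [norm_div]
    gcongr
    · exact norm_lowerLaplace_le hi₁ hs₁ hz
    · exact hδ' z hz
  · simp only [hW₁]
    refine (hW'.memLp.const_mul ((δ⁻¹ : ℝ) : ℂ)).of_le ?_ (Eventually.of_forall fun x => ?_)
    · exact (hW'.continuous.div (continuous_const.add hW'.continuous) hne).aestronglyMeasurable
    · rw [norm_div, norm_mul, Complex.norm_real, Real.norm_of_nonneg (by positivity), div_eq_inv_mul]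
      gcongr
      simpa [hW₁] using hδ' x (by simp)

/-! ### The water wave equations for a steady profile, given Bernoulli's law. -/

theorem MeasureTheory.MemLp.top_mul {f g : ℝ → ℂ} {p : ℝ≥0∞} (hf : MemLp f ∞ volume)
    (hg : MemLp g p volume) : MemLp (fun x => f x * g x) p volume :=
  hg.mul hf

theorem IsH1.memLp_top {f f' : ℝ → ℂ} (h : IsH1 f f') : MemLp f ∞ volume := by
  obtain ⟨C, hC⟩ := h.exists_bound
  exact memLp_top_of_bound h.continuous.aestronglyMeasurable C (Eventually.of_forall hC)

/-- The properties of the traces `w` and `q` of a steady wave used to evaluate the nonlocal terms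
of the water wave system; `u` is the imaginary part of `w`. -/
structure IsSteadyProfile (γ c : ℝ) (u : ℝ → ℝ) (w q : ℝ → ℂ) : Prop where
  neg_w : HasNegSpectrum w
  top_w : MemLp w ∞ volume
  neg_q : HasNegSpectrum q
  neg_dw : HasNegSpectrum (deriv w)
  top_dw : MemLp (deriv w) ∞ volume
  neg_dq : HasNegSpectrum (deriv q)
  top_dq : MemLp (deriv q) ∞ volume
  ne_zero : ∀ x, 1 + deriv w x ≠ 0
  top_inv : MemLp (fun x => (1 + deriv w x)⁻¹) ∞ volume
  neg_div : HasNegSpectrum fun x => deriv w x / (1 + deriv w x)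
  sub_star_w : ∀ x, w x - star (w x) = 2 * Complex.I * u x
  sub_star_q : ∀ x, q x - star (q x) = -2 * Complex.I * (c * u x + γ / 2 * (u x : ℂ) ^ 2)
  sub_star_dq : ∀ x, deriv q x - star (deriv q x)
    = -(c + γ * u x) * (deriv w x - star (deriv w x))

/-- The value of the nonlocal velocity term of a steady wave. -/
def steadyVelocity (γ c : ℝ) (w : ℝ → ℂ) (x : ℝ) : ℂ :=
  -c * (deriv w x / (1 + deriv w x))
    - Complex.I * (γ / 2) * (w x - w x * (deriv w x / (1 + deriv w x)))

namespace IsSteadyProfile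

variable {γ c : ℝ} {u : ℝ → ℝ} {w q : ℝ → ℂ}

theorem star_ne_zero (h : IsSteadyProfile γ c u w q) (x : ℝ) : 1 + star (deriv w x) ≠ 0 := by
  have := h.ne_zero x
  intro h0
  refine this ?_
  have := congrArg star h0
  simpa using this

theorem waveJ_eq (w : ℝ → ℂ) (x : ℝ) :
    (waveJ w x : ℂ) = (1 + deriv w x) * (1 + star (deriv w x)) := by
  have := Complex.mul_conj' (1 + deriv w x)
  rw [map_add, map_one] at this
  rw [waveJ]
  push_cast
  exact this.symm

theorem top_star_inv (h : IsSteadyProfile γ c u w q) :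
    MemLp (fun x => (1 + star (deriv w x))⁻¹) ∞ volume := by
  refine h.top_inv.star.ae_eq (Eventually.of_forall fun x => ?_)
  simp

theorem top_div (h : IsSteadyProfile γ c u w q) :
    MemLp (fun x => deriv w x / (1 + deriv w x)) ∞ volume := by
  simpa only [div_eq_mul_inv] using h.top_dw.top_mul h.top_inv

/-- Writing w/(1 + w') as w - w · w'/(1 + w') leaves only products of Hardy functions; 1/(1 + w')
itself is not square integrable. -/
theorem neg_steadyVelocity (h : IsSteadyProfile γ c u w q) :
    HasNegSpectrum (steadyVelocity γ c w) :=
  (h.neg_div.const_mul _).sub ((h.neg_w.sub (h.neg_w.mul h.neg_div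
    (h.top_w.top_mul h.neg_div.memLp))).const_mul _)

theorem top_steadyVelocity (h : IsSteadyProfile γ c u w q) :
    MemLp (steadyVelocity γ c w) ∞ volume :=
  (h.top_div.const_mul _).sub ((h.top_w.sub (h.top_w.top_mul h.top_div)).const_mul _)

theorem memLp_velocity_integrand (h : IsSteadyProfile γ c u w q) :
    MemLp (fun x => (deriv q x - star (deriv q x)) / (waveJ w x : ℂ)) 2 volume := by
  refine (h.top_inv.top_mul (h.top_star_inv.top_mul
    (h.neg_dq.memLp.sub h.neg_dq.memLp.star))).ae_eq (Eventually.of_forall fun x => ?_)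
  have h1 := h.ne_zero x
  have h2 := h.star_ne_zero x
  simp only [Pi.sub_apply, Pi.star_apply]
  rw [waveJ_eq]
  field_simp

theorem memLp_vorticity_integrand (h : IsSteadyProfile γ c u w q) :
    MemLp (fun x => w x / (1 + star (deriv w x)) + star (w x) / (1 + deriv w x)) 2 volume := by
  refine ((h.top_star_inv.top_mul h.neg_w.memLp).add
    (h.top_inv.top_mul h.neg_w.memLp.star)).ae_eq (Eventually.of_forall fun x => ?_)
  simp only [Pi.add_apply, Pi.star_apply]
  ring

/-- After u is expressed through w and its conjugate, the function being projected is V - V̄ with V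
= `steadyVelocity γ c w`, and P keeps V. -/
theorem waveFUnderline_ae_eq (h : IsSteadyProfile γ c u w q) :
    waveFUnderline γ w q =ᵐ[volume] steadyVelocity γ c w := by
  have h1 := projNeg_sub_const_mul h.memLp_velocity_integrand h.memLp_vorticity_integrand
    (Complex.I * (γ / 2))
  refine EventuallyEq.trans ?_ (h1.symm.trans
    (projNeg_ae_eq_of_add h.neg_steadyVelocity h.neg_steadyVelocity.neg.star ?_))
  · exact Eventually.of_forall fun x => rfl
  · refine Eventually.of_forall fun x => ?_
    have e1 := h.ne_zero x
    have e2 := h.star_ne_zero x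
    have e3 := h.sub_star_w x
    have e4 : (u x : ℂ) = -Complex.I * (w x - star (w x)) / 2 := by
      rw [e3]; linear_combination (u x : ℂ) * Complex.I_mul_I
    rw [waveJ_eq, h.sub_star_dq, e4]
    simp only [steadyVelocity, star_neg, star_sub, star_mul', star_div₀, star_add, star_one]
    simp only [Complex.star_def, Complex.conj_I, Complex.conj_ofReal, map_ofNat] at e2 ⊢
    generalize conj (deriv w x) = W' at *
    generalize conj (w x) = w' at *
    field_simp
    ring

/-- The kinematic equation of a steady wave. -/
theorem kinematic (h : IsSteadyProfile γ c u w q) :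
    ∀ᵐ x, c * deriv w x + (deriv w x + 1) * waveFUnderline γ w q x
      + Complex.I * (γ / 2) * w x = 0 := by
  filter_upwards [h.waveFUnderline_ae_eq] with x hx
  have e1 := h.ne_zero x
  rw [hx, steadyVelocity]
  field_simp
  ring

/-- The part with nonpositive frequencies of the dynamic equation of a steady wave. -/
def steadyDynamic (g γ c : ℝ) (w q : ℝ → ℂ) (x : ℝ) : ℂ :=
  c * deriv q x - Complex.I * g * w x + steadyVelocity γ c w x * deriv q x
    + Complex.I * γ * q x

theorem neg_steadyDynamic (h : IsSteadyProfile γ c u w q) (g : ℝ) :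
    HasNegSpectrum (steadyDynamic g γ c w q) :=
  (((h.neg_dq.const_mul _).sub (h.neg_w.const_mul _)).add (h.neg_steadyVelocity.mul h.neg_dq
    (h.top_steadyVelocity.top_mul h.neg_dq.memLp))).add (h.neg_q.const_mul _)

theorem memLp_kinetic (h : IsSteadyProfile γ c u w q) :
    MemLp (fun x => ((‖deriv q x‖ ^ 2 / waveJ w x : ℝ) : ℂ)) 2 volume := by
  refine (h.top_inv.top_mul (h.top_star_inv.top_mul
    (h.top_dq.top_mul h.neg_dq.memLp.star))).ae_eq (Eventually.of_forall fun x => ?_)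
  have h1 := h.ne_zero x
  have h2 := h.star_ne_zero x
  push_cast
  rw [waveJ_eq, ← Complex.mul_conj']
  simp only [Pi.star_apply]
  field_simp
  rfl

theorem memLp_transport (h : IsSteadyProfile γ c u w q) :
    MemLp (fun x => w x * star (deriv q x) / (1 + star (deriv w x))
      - star (w x) * deriv q x / (1 + deriv w x)) 2 volume := by
  refine ((h.top_star_inv.top_mul (h.top_dq.star.top_mul h.neg_w.memLp)).sub
    (h.top_inv.top_mul (h.top_dq.top_mul h.neg_w.memLp.star))).ae_eq
    (Eventually.of_forall fun x => ?_)
  simp only [Pi.sub_apply, Pi.star_apply]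
  ring

/-- The dynamic equation of a steady wave follows from Bernoulli's law at the free surface. -/
theorem dynamic (h : IsSteadyProfile γ c u w q) {g σ : ℝ} {κ : ℝ → ℝ}
    (hκm : MemLp (fun x => (κ x : ℂ)) 2 volume)
    (hκ : ∀ᵐ x, (deriv (deriv w) x / ((√(waveJ w x) : ℂ) * (1 + deriv w x))).im = κ x)
    (hB : ∀ᵐ x, (deriv q x + (c + γ * u x) * (1 + deriv w x)) *
        (star (deriv q x) + (c + γ * u x) * (1 + star (deriv w x)))
      = (1 + deriv w x) * (1 + star (deriv w x)) * (c ^ 2 - 2 * g * u x + 2 * σ * κ x)) :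
    ∀ᵐ x, c * deriv q x - Complex.I * g * w x
      + waveFUnderline γ w q x * deriv q x + Complex.I * γ * q x
      + waveKinetic w q x - Complex.I * (γ / 2) * waveT1 w q x
      - 2 * σ * waveCapillary w x = 0 := by
  have hκ' : (fun x => (((deriv (deriv w) x / ((√(waveJ w x) : ℂ) * (1 + deriv w x))).im : ℝ) : ℂ))
      =ᵐ[volume] fun x => (κ x : ℂ) := by
    filter_upwards [hκ] with x hx
    rw [hx]
  have hcap := hκm.ae_eq hκ'.symm
  have h1 := projNeg_sub_const_mul h.memLp_kinetic h.memLp_transport (Complex.I * (γ / 2))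
  have h2 := projNeg_sub_const_mul (h.memLp_kinetic.sub (h.memLp_transport.const_mul
    (Complex.I * (γ / 2)))) hcap (2 * σ)
  -- The three projected terms add up to -(D + D̄), with D = `steadyDynamic g γ c w q`.
  have h3 := projNeg_ae_eq_of_add (h.neg_steadyDynamic g).neg (h.neg_steadyDynamic g).neg.star
    (f := fun x => ((‖deriv q x‖ ^ 2 / waveJ w x : ℝ) : ℂ)
      - Complex.I * (γ / 2) * (w x * star (deriv q x) / (1 + star (deriv w x))
      - star (w x) * deriv q x / (1 + deriv w x)) - 2 * σ *
      (((deriv (deriv w) x / ((√(waveJ w x) : ℂ) * (1 + deriv w x))).im : ℝ) : ℂ)) ?_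
  · filter_upwards [h1, h2, h3, h.waveFUnderline_ae_eq] with x e1 e2 e3 e4
    have e5 := e2.symm.trans e3
    simp only [Pi.sub_def] at e5
    rw [e1] at e5
    rw [e4]
    simp only [waveKinetic, waveT1, waveCapillary]
    rw [steadyDynamic] at e5
    linear_combination e5
  · filter_upwards [hκ, hB] with x hx hBx
    rw [hx]
    push_cast
    rw [waveJ_eq, ← Complex.mul_conj']
    have e1 := h.ne_zero x
    have e2 := h.star_ne_zero x
    have e3 : w x = star (w x) + 2 * Complex.I * u x := by rw [← h.sub_star_w]; ring
    have e4 : q x = star (q x) + -2 * Complex.I * (c * u x + γ / 2 * (u x : ℂ) ^ 2) := by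
      rw [← h.sub_star_q]; ring
    simp only [steadyDynamic, steadyVelocity, star_neg, star_sub, star_mul', star_div₀, star_add,
      star_one]
    simp only [Complex.star_def, Complex.conj_I, Complex.conj_ofReal, map_ofNat] at e2 e3 e4 hBx ⊢
    generalize conj (deriv w x) = W' at *
    generalize conj (w x) = w' at *
    generalize conj (q x) = q' at *
    generalize conj (deriv q x) = Q' at *
    rw [e3, e4]
    generalize deriv w x = W at *
    generalize deriv q x = Q at *
    -- Bernoulli's law solved for |q'|²; substituting it makes the splitting an algebraic identity.
    have e5 : Q * Q' = (1 + W) * (1 + W') * (c ^ 2 - 2 * g * u x + 2 * σ * κ x)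
      - Q * ((c + γ * u x) * (1 + W')) - Q' * ((c + γ * u x) * (1 + W))
      - (c + γ * u x) ^ 2 * (1 + W) * (1 + W') := by linear_combination hBx
    rw [e5]
    field_simp
    ring_nf
    simp only [Complex.I_sq]
    ring

end IsSteadyProfile

/-! ### Classical derivatives of real-valued Sobolev functions. -/

theorem IsH1.congr_deriv {v w w' : ℝ → ℂ} (h : IsH1 v w) (e : w =ᵐ[volume] w') : IsH1 v w' := by
  refine ⟨h.continuous, h.memLp, h.memLp_deriv.ae_eq e, fun a b => ?_⟩
  rw [h.integral_eq]
  exact intervalIntegral.integral_congr_ae (e.mono fun x hx _ => hx)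

theorem hasDerivAt_ofReal_eq {f : ℝ → ℝ} {z : ℂ} {x : ℝ}
    (h : HasDerivAt (fun x => (f x : ℂ)) z x) : HasDerivAt f z.re x ∧ z = ((deriv f x : ℝ) : ℂ) := by
  have h1 : HasDerivAt f z.re x := Complex.reCLM.hasFDerivAt.comp_hasDerivAt x h
  have h2 : HasDerivAt (fun _ : ℝ => (0 : ℝ)) z.im x := by
    have := Complex.imCLM.hasFDerivAt.comp_hasDerivAt x h
    simpa [Function.comp_def] using this
  refine ⟨h1, Complex.ext (by simpa using h1.deriv.symm) ?_⟩
  simpa using h2.unique (hasDerivAt_const x (0 : ℝ))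

theorem IsH1.ae_hasDerivAt_ofReal {f f' : ℝ → ℝ}
    (h : IsH1 (fun x => (f x : ℂ)) (fun x => (f' x : ℂ))) : ∀ᵐ x, HasDerivAt f (f' x) x := by
  filter_upwards [h.ae_hasDerivAt] with x hx
  simpa using (hasDerivAt_ofReal_eq hx).1

theorem MemH2.isH1_deriv {u : ℝ → ℝ} (h : MemH2 fun x => (u x : ℂ)) :
    IsH1 (fun x => (u x : ℂ)) (fun x => ((deriv u x : ℝ) : ℂ)) ∧
      IsH1 (fun x => ((deriv u x : ℝ) : ℂ)) (fun x => ((deriv (deriv u) x : ℝ) : ℂ)) := by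
  obtain ⟨f', f'', h1, h2⟩ := h.exists_isH1
  have e1 : f' = fun x => ((deriv u x : ℝ) : ℂ) :=
    funext fun x => (hasDerivAt_ofReal_eq (h1.hasDerivAt h2.continuous x)).2
  rw [e1] at h1 h2
  refine ⟨h1, h2.congr_deriv ?_⟩
  filter_upwards [h2.ae_hasDerivAt] with x hx
  exact (hasDerivAt_ofReal_eq hx).2

/-! ### The Hilbert transform of real-valued functions -/

theorem IsH1.hilbert_ofReal_eq {f : ℝ → ℝ} {f' : ℝ → ℂ} (h : IsH1 (fun x => (f x : ℂ)) f') :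
    _root_.hilbert (fun x => (f x : ℂ)) = fun x => (hilbertReal f x : ℂ) := by
  have hc : Continuous (fun x => (hilbertReal f x : ℂ)) :=
    Complex.continuous_ofReal.comp (Complex.continuous_re.comp h.hilbert.continuous)
  exact Continuous.ae_eq_iff_eq volume h.hilbert.continuous hc |>.1 (hilbert_ofReal h.memLp)

theorem IsH1.hilbertReal {f f' : ℝ → ℝ}
    (h : IsH1 (fun x => (f x : ℂ)) (fun x => (f' x : ℂ))) :
    IsH1 (fun x => (hilbertReal f x : ℂ)) (fun x => (hilbertReal f' x : ℂ)) := by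
  have h1 := h.hilbert
  rw [h.hilbert_ofReal_eq] at h1
  exact h1.congr_deriv (hilbert_ofReal h.memLp_deriv)

theorem hilbertReal_congr {f g : ℝ → ℝ} (h : f =ᵐ[volume] g) : hilbertReal f = hilbertReal g := by
  unfold hilbertReal
  rw [hilbert_congr (g := fun x => (g x : ℂ)) (h.mono fun x hx => by simp only [hx])]

theorem hilbertReal_add {f g : ℝ → ℝ} (hf : MemLp (fun x => (f x : ℂ)) 2 volume)
    (hg : MemLp (fun x => (g x : ℂ)) 2 volume) :
    hilbertReal (fun x => f x + g x) =ᵐ[volume] fun x => hilbertReal f x + hilbertReal g x := by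
  filter_upwards [hilbert_add hf hg] with x hx
  simp only [hilbertReal, Complex.ofReal_add]
  rw [hx, Complex.add_re]

theorem hilbertReal_const_mul {f : ℝ → ℝ} (hf : MemLp (fun x => (f x : ℂ)) 2 volume) (r : ℝ) :
    hilbertReal (fun x => r * f x) =ᵐ[volume] fun x => r * hilbertReal f x := by
  filter_upwards [hilbert_const_mul hf r] with x hx
  simp only [hilbertReal, Complex.ofReal_mul]
  rw [hx, Complex.re_ofReal_mul]

theorem im_hilbert {f : ℝ → ℂ} (hf : MemLp f 2 volume) :
    ∀ᵐ x, (hilbert f x).im = hilbertReal (fun y => (f y).im) x := by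
  have h1 : MemLp (fun x => ((f x).re : ℂ)) 2 volume := hf.re.ofReal
  have h2 : MemLp (fun x => ((f x).im : ℂ)) 2 volume := hf.im.ofReal
  have e : f = fun x => ((f x).re : ℂ) + Complex.I * ((f x).im : ℂ) := by
    funext x
    rw [mul_comm, Complex.re_add_im]
  have e' := congrArg hilbert e
  filter_upwards [hilbert_add h1 (h2.const_mul Complex.I), hilbert_const_mul h2 Complex.I,
    hilbert_ofReal h1, hilbert_ofReal h2] with x a b c d
  rw [e', a, b, c, d]
  simp

/-- The trace `H f + i f` of a holomorphic function in the lower half-plane. -/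
def holTrace (f : ℝ → ℝ) (x : ℝ) : ℂ := (hilbertReal f x : ℂ) + Complex.I * (f x : ℂ)

theorem IsH1.holTrace {f f' : ℝ → ℝ} (h : IsH1 (fun x => (f x : ℂ)) (fun x => (f' x : ℂ))) :
    IsH1 (holTrace f) (holTrace f') :=
  h.hilbertReal.add (h.const_mul _)

theorem hasNegSpectrum_holTrace {f : ℝ → ℝ} (hf : MemLp (fun x => (f x : ℂ)) 2 volume) :
    HasNegSpectrum (holTrace f) := by
  refine ((hasNegSpectrum_projNeg hf).const_mul (2 * Complex.I)).congr ?_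
  filter_upwards [hilbert_ofReal hf] with x hx
  rw [projNeg, hx, _root_.holTrace]
  linear_combination (-(hilbertReal f x : ℂ)) * Complex.I_mul_I

/-! ### Curvature -/

/-- The form isolates the factor (r'p - p'r)/(p² + r²)^(3/2), a curvature. It changes sign when p
and r are exchanged, so one statement serves both components of a unit tangent. -/
theorem hasDerivAt_div_sqrt {p r : ℝ → ℝ} {p' r' x : ℝ} (hp : HasDerivAt p p' x)
    (hr : HasDerivAt r r' x) (hJ : p x ^ 2 + r x ^ 2 ≠ 0) :
    HasDerivAt (fun y => p y / √(p y ^ 2 + r y ^ 2))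
      (-(r x * ((r' * p x - p' * r x) / (√(p x ^ 2 + r x ^ 2) * (p x ^ 2 + r x ^ 2))))) x := by
  have hJ0 : 0 < p x ^ 2 + r x ^ 2 := lt_of_le_of_ne (by positivity) hJ.symm
  have hs : 0 < √(p x ^ 2 + r x ^ 2) := Real.sqrt_pos.2 hJ0
  have hsq : √(p x ^ 2 + r x ^ 2) ^ 2 = p x ^ 2 + r x ^ 2 := Real.sq_sqrt hJ0.le
  have h1 := ((hp.pow 2).add (hr.pow 2)).sqrt hJ
  refine (hp.div h1 hs.ne').congr_deriv ?_
  simp only [Pi.add_apply, Pi.pow_apply]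
  rw [hsq]
  generalize √(p x ^ 2 + r x ^ 2) = S at *
  field_simp
  rw [hsq]
  norm_num
  ring

/-! ### The profiles w and q attached to a solution of the Babenko equation. -/

section Babenko

variable {g γ σ c : ℝ} {u : ℝ → ℝ}

/-- The trace of `Q` for a steady wave. -/
def steadyQ (γ c : ℝ) (u : ℝ → ℝ) (x : ℝ) : ℂ :=
  -c * holTrace u x + -(γ / 2) * holTrace (fun y => u y ^ 2) x

theorem isH1_sq (hu : MemH2 fun x => (u x : ℂ)) :
    IsH1 (fun x => ((u x ^ 2 : ℝ) : ℂ)) (fun x => ((2 * (u x * deriv u x) : ℝ) : ℂ)) ∧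
    ∃ f : ℝ → ℝ, IsH1 (fun x => ((2 * (u x * deriv u x) : ℝ) : ℂ)) (fun x => (f x : ℂ)) := by
  obtain ⟨h1, h2⟩ := hu.isH1_deriv
  constructor
  · have h := h1.ofReal_mul h1
    convert! h using 3 with x
    · rw [sq]
    · ring
  · refine ⟨fun x => 2 * (deriv u x * deriv u x + u x * deriv (deriv u) x), ?_⟩
    have h := (h1.ofReal_mul h2).const_mul 2
    simpa using h

theorem hasDerivAt_of_memH2 (hu : MemH2 fun x => (u x : ℂ)) (x : ℝ) :
    HasDerivAt u (deriv u x) x := by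
  obtain ⟨h1, h2⟩ := hu.isH1_deriv
  simpa using (hasDerivAt_ofReal_eq (h1.hasDerivAt h2.continuous x)).1

theorem deriv_sq (hu : MemH2 fun x => (u x : ℂ)) :
    deriv (fun y => u y ^ 2) = fun x => 2 * (u x * deriv u x) := by
  funext x
  refine ((hasDerivAt_of_memH2 hu x).pow 2).deriv.trans ?_
  simp
  ring

theorem deriv_cube (hu : MemH2 fun x => (u x : ℂ)) :
    deriv (fun y => u y ^ 3) = fun x => 3 * (u x ^ 2 * deriv u x) := by
  funext x
  refine ((hasDerivAt_of_memH2 hu x).pow 3).deriv.trans ?_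
  simp
  ring

theorem isH1_holTrace (hu : MemH2 fun x => (u x : ℂ)) :
    IsH1 (holTrace u) (holTrace (deriv u)) ∧
      IsH1 (holTrace (deriv u)) (holTrace (deriv (deriv u))) :=
  ⟨hu.isH1_deriv.1.holTrace, hu.isH1_deriv.2.holTrace⟩

/-- The derivative of `steadyQ`. -/
def steadyDQ (γ c : ℝ) (u : ℝ → ℝ) (x : ℝ) : ℂ :=
  -c * holTrace (deriv u) x + -(γ / 2) * holTrace (fun y => 2 * (u y * deriv u y)) x

theorem isH1_steadyQ (hu : MemH2 fun x => (u x : ℂ)) :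
    IsH1 (steadyQ γ c u) (steadyDQ γ c u) ∧ ∃ f, IsH1 (steadyDQ γ c u) f := by
  obtain ⟨h1, h2⟩ := isH1_holTrace hu
  obtain ⟨h3, f, h4⟩ := isH1_sq hu
  exact ⟨(h1.const_mul _).add (h3.holTrace.const_mul _), _,
    (h2.const_mul _).add (h4.holTrace.const_mul _)⟩

theorem deriv_holTrace (hu : MemH2 fun x => (u x : ℂ)) :
    deriv (holTrace u) = holTrace (deriv u) :=
  (isH1_holTrace hu).1.deriv_eq (isH1_holTrace hu).2.continuous

theorem deriv_steadyQ (hu : MemH2 fun x => (u x : ℂ)) :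
    deriv (steadyQ γ c u) = steadyDQ γ c u :=
  (isH1_steadyQ hu).1.deriv_eq (isH1_steadyQ hu).2.choose_spec.continuous

theorem hasNegSpectrum_steadyQ (hu : MemH2 fun x => (u x : ℂ)) :
    HasNegSpectrum (steadyQ γ c u) :=
  ((hasNegSpectrum_holTrace hu.isH1_deriv.1.memLp).const_mul _).add
    ((hasNegSpectrum_holTrace (isH1_sq hu).1.memLp).const_mul _)

theorem normSq_one_add_holTrace (x : ℝ) :
    ‖1 + holTrace (deriv u) x‖ ^ 2 = babenkoJ u x := by
  rw [← Complex.normSq_eq_norm_sq, Complex.normSq_apply, holTrace, babenkoJ, absD]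
  simp
  ring

theorem IsBabenkoSolution.isSteadyProfile (hu : IsBabenkoSolution g γ σ c u)
    (hconf : IsConformalProfile u) :
    IsSteadyProfile γ c u (holTrace u) (steadyQ γ c u) := by
  have hm := hu.memH2
  obtain ⟨h1, h2⟩ := isH1_holTrace hm
  obtain ⟨h3, f, h4⟩ := isH1_steadyQ (γ := γ) (c := c) hm
  obtain ⟨k1, k2⟩ := hm.isH1_deriv
  have hne : ∀ x, 1 + holTrace (deriv u) x ≠ 0 := fun x h0 => by
    have := normSq_one_add_holTrace (u := u) x
    rw [h0] at this
    exact hu.jacobian_ne_zero x (by simpa using this.symm)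
  have hH : ∀ x, hilbert (fun x => ((deriv u x : ℝ) : ℂ)) x + Complex.I * ((deriv u x : ℝ) : ℂ)
      = holTrace (deriv u) x := fun x => by
    rw [k2.hilbert_ofReal_eq]; rfl
  obtain ⟨hR, δ, hδ, hδ'⟩ := hasNegSpectrum_div_one_add k1 k2 hconf (fun x => by
    rw [hH]; exact hne x)
  simp only [hH] at hR hδ'
  have hnw := hasNegSpectrum_holTrace k1.memLp
  have hnq := hasNegSpectrum_steadyQ (γ := γ) (c := c) hm
  refine ⟨hnw, h1.memLp_top, hnq, ?_, ?_, ?_, ?_, ?_, ?_, ?_, ?_, ?_, ?_⟩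
  · rw [deriv_holTrace hm]; exact h1.hasNegSpectrum hnw
  · rw [deriv_holTrace hm]; exact h2.memLp_top
  · rw [deriv_steadyQ hm]; exact h3.hasNegSpectrum hnq
  · rw [deriv_steadyQ hm]; exact h4.memLp_top
  · rw [deriv_holTrace hm]; exact hne
  · rw [deriv_holTrace hm]
    refine memLp_top_of_bound
      ((continuous_const.add h2.continuous).inv₀ hne).aestronglyMeasurable δ⁻¹
      (Eventually.of_forall fun x => ?_)
    rw [norm_inv]
    gcongr
    exact hδ' x
  · rw [deriv_holTrace hm]; exact hR
  · intro x
    simp [holTrace]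
    ring
  · intro x
    simp [steadyQ, holTrace]
    ring
  · intro x
    rw [deriv_holTrace hm, deriv_steadyQ hm]
    simp [steadyDQ, holTrace]
    ring

end Babenko

/-! ### From the Babenko equation to Bernoulli's law. -/

section Bernoulli

variable {g γ σ c : ℝ} {u : ℝ → ℝ}

/-- The curvature of the free surface. -/
def surfaceCurvature (u : ℝ → ℝ) (x : ℝ) : ℝ :=
  (holTrace (deriv (deriv u)) x /
    ((√(waveJ (holTrace u) x) : ℂ) * (1 + deriv (holTrace u) x))).im

theorem IsSteadyProfile.memLp_surfaceCurvature {q : ℝ → ℂ} (hu : MemH2 fun x => (u x : ℂ))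
    (h : IsSteadyProfile γ c u (holTrace u) q) :
    MemLp (fun x => (surfaceCurvature u x : ℂ)) 2 volume := by
  have h1 : MemLp (fun x => ((‖(1 + deriv (holTrace u) x)⁻¹‖ : ℝ) : ℂ)) ∞ volume :=
    h.top_inv.norm.ofReal
  have h2 := h1.top_mul (h.top_inv.top_mul (isH1_holTrace hu).2.memLp_deriv)
  have key : ∀ x, (((‖(1 + deriv (holTrace u) x)⁻¹‖ : ℝ) : ℂ) * ((1 + deriv (holTrace u) x)⁻¹ *
      holTrace (deriv (deriv u)) x)).im = surfaceCurvature u x := by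
    intro x
    have e : √(waveJ (holTrace u) x) = ‖1 + deriv (holTrace u) x‖ := by
      rw [waveJ, Real.sqrt_sq (norm_nonneg _)]
    rw [surfaceCurvature, e]
    congr 1
    rw [norm_inv, Complex.ofReal_inv, div_eq_mul_inv, mul_inv]
    ring
  exact (h2.im.ae_eq (Eventually.of_forall key)).ofReal

theorem surfaceCurvature_eq (hu : MemH2 fun x => (u x : ℂ)) {x : ℝ} (hJ : babenkoJ u x ≠ 0) :
    surfaceCurvature u x = (deriv (deriv u) x * (1 + absD u x)
      - hilbertReal (deriv (deriv u)) x * deriv u x) / (√(babenkoJ u x) * babenkoJ u x) := by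
  have hJ0 : 0 < babenkoJ u x := lt_of_le_of_ne (by rw [babenkoJ]; positivity) hJ.symm
  have hs := Real.sqrt_pos.2 hJ0
  have e : waveJ (holTrace u) x = babenkoJ u x := by
    rw [waveJ, deriv_holTrace hu, normSq_one_add_holTrace]
  rw [surfaceCurvature, e, deriv_holTrace hu, Complex.div_im]
  have e2 : Complex.normSq ((√(babenkoJ u x) : ℂ) * (1 + holTrace (deriv u) x))
      = babenkoJ u x * babenkoJ u x := by
    rw [Complex.normSq_mul, Complex.normSq_ofReal, Real.mul_self_sqrt hJ0.le,
      Complex.normSq_eq_norm_sq, normSq_one_add_holTrace]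
  rw [e2]
  have h2 := Real.mul_self_sqrt hJ0.le
  simp only [holTrace, absD]
  simp
  generalize babenkoJ u x = J at *
  generalize √J = S at *
  subst h2
  field_simp

/-- Frenet's formulas for the unit tangent (1 + |D|u, u')/√J; they turn both capillary terms of the
Babenko equation into curvature terms. -/
theorem deriv_tangent (hu : IsBabenkoSolution g γ σ c u) :
    ∀ᵐ x, deriv (fun β => (1 + absD u β) / √(babenkoJ u β)) x
        = -(deriv u x * surfaceCurvature u x) ∧
      deriv (fun β => deriv u β / √(babenkoJ u β)) x
        = (1 + absD u x) * surfaceCurvature u x := by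
  obtain ⟨k1, k2⟩ := hu.memH2.isH1_deriv
  filter_upwards [k2.ae_hasDerivAt_ofReal, k2.hilbertReal.ae_hasDerivAt_ofReal] with x h1 h2
  have hJ := hu.jacobian_ne_zero x
  have h3 : HasDerivAt (fun y => 1 + absD u y) (hilbertReal (deriv (deriv u)) x) x :=
    h2.const_add 1
  rw [surfaceCurvature_eq hu.memH2 hJ]
  have hJ' : deriv u x ^ 2 + (1 + absD u x) ^ 2 ≠ 0 := by rwa [add_comm]
  refine ⟨(hasDerivAt_div_sqrt h3 h1 hJ).deriv, ?_⟩
  have h4 := (hasDerivAt_div_sqrt h1 h3 hJ').deriv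
  have e : (fun β => deriv u β / √(babenkoJ u β))
      = fun y => deriv u y / √(deriv u y ^ 2 + (1 + absD u y) ^ 2) := by
    funext y
    rw [babenkoJ, add_comm]
  rw [e, h4, babenkoJ, add_comm (deriv u x ^ 2)]
  ring

/-- The function whose projection to nonpositive frequencies is described by the Babenko
equation. -/
def babenkoSymbol (g γ σ c : ℝ) (u : ℝ → ℝ) (x : ℝ) : ℂ :=
  (c ^ 2 - 2 * g * u x + 2 * σ * surfaceCurvature u x) * (1 + holTrace (deriv u) x)
    - 2 * (c + γ * u x) * star (steadyDQ γ c u x)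
    - (c + γ * u x) ^ 2 * (1 + star (holTrace (deriv u) x))

theorem im_babenkoSymbol (x : ℝ) : (babenkoSymbol g γ σ c u x).im
    = -(g + c * γ) * (2 * (u x * deriv u x)) + (-(γ ^ 2 / 3) * (3 * (u x ^ 2 * deriv u x))
      + -2 * σ * -(deriv u x * surfaceCurvature u x)) := by
  simp [babenkoSymbol, holTrace, steadyDQ, sq]
  ring

theorem re_babenkoSymbol (x : ℝ) : (babenkoSymbol g γ σ c u x).re
    = (c ^ 2 - 2 * g * u x + 2 * σ * surfaceCurvature u x) * (1 + hilbertReal (deriv u) x)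
      - 2 * (c + γ * u x) * (-c * hilbertReal (deriv u) x
        + -(γ / 2) * hilbertReal (fun y => 2 * (u y * deriv u y)) x)
      - (c + γ * u x) ^ 2 * (1 + hilbertReal (deriv u) x) := by
  simp [babenkoSymbol, holTrace, steadyDQ, sq]

theorem memLp_babenkoSymbol (hu : MemH2 fun x => (u x : ℂ))
    (h : IsSteadyProfile γ c u (holTrace u) (steadyQ γ c u)) :
    MemLp (babenkoSymbol g γ σ c u) 2 volume := by
  have k1 := hu.isH1_deriv.1
  have h2 := (isH1_holTrace hu).2
  have hκ := h.memLp_surfaceCurvature hu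
  have h1 : MemLp (fun _ : ℝ => (1 : ℂ)) ∞ volume := memLp_top_const 1
  have hc : MemLp (fun _ : ℝ => (c : ℂ)) ∞ volume := memLp_top_const _
  have hA : MemLp (fun x => 1 + holTrace (deriv u) x) ∞ volume := h1.add h2.memLp_top
  have hA' : MemLp (fun x => 1 + star (holTrace (deriv u) x)) ∞ volume :=
    h1.add h2.memLp_top.star
  have hdq : MemLp (fun x => star (steadyDQ γ c u x)) 2 volume :=
    (isH1_steadyQ hu).1.memLp_deriv.star
  have hu' : MemLp (fun x => (c + γ * u x : ℂ)) ∞ volume :=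
    hc.add (k1.memLp_top.const_mul _)
  -- The constants c² in the first and last terms of the symbol are not square integrable, but they
  -- cancel and leave c²(w' - w̄').
  have t1 : MemLp (fun x => (c : ℂ) ^ 2 *
      (holTrace (deriv u) x - star (holTrace (deriv u) x))) 2 volume :=
    (h2.memLp.sub h2.memLp.star).const_mul _
  have t2 : MemLp (fun x => (1 + holTrace (deriv u) x) *
      (-2 * g * (u x : ℂ) + 2 * σ * (surfaceCurvature u x : ℂ))) 2 volume :=
    hA.top_mul ((k1.memLp.const_mul _).add (hκ.const_mul _))
  have t3 : MemLp (fun x => (c + γ * u x : ℂ) * star (steadyDQ γ c u x)) 2 volume :=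
    hu'.top_mul hdq
  have t4 : MemLp (fun x => (1 + star (holTrace (deriv u) x)) *
      (2 * c * γ * (u x : ℂ) + (u x : ℂ) * ((γ : ℂ) ^ 2 * (u x : ℂ)))) 2 volume :=
    hA'.top_mul ((k1.memLp.const_mul _).add (k1.memLp_top.top_mul (k1.memLp.const_mul _)))
  have t := ((t1.add t2).sub (t3.const_mul 2)).sub t4
  refine t.ae_eq (Eventually.of_forall fun x => ?_)
  simp only [Pi.add_apply, Pi.sub_apply, babenkoSymbol]
  generalize star (holTrace (deriv u) x) = W'
  generalize star (steadyDQ γ c u x) = Q'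
  ring

/-- The Babenko equation says that `babenkoSymbol` has nonnegative frequencies. -/
theorem hasPosSpectrum_babenkoSymbol (hu : IsBabenkoSolution g γ σ c u)
    (h : IsSteadyProfile γ c u (holTrace u) (steadyQ γ c u)) :
    HasPosSpectrum (babenkoSymbol g γ σ c u) := by
  have hm := hu.memH2
  obtain ⟨k1, k2⟩ := hm.isH1_deriv
  have hL := memLp_babenkoSymbol (g := g) (σ := σ) hm h
  have hκ := h.memLp_surfaceCurvature hm
  have m1 : MemLp (fun x => ((2 * (u x * deriv u x) : ℝ) : ℂ)) 2 volume := (isH1_sq hm).1.memLp_deriv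
  have m2 : MemLp (fun x => ((3 * (u x ^ 2 * deriv u x) : ℝ) : ℂ)) 2 volume := by
    refine ((k1.memLp_top.top_mul (k1.memLp_top.top_mul k1.memLp_deriv)).const_mul 3).ae_eq
      (Eventually.of_forall fun x => ?_)
    push_cast
    ring
  have m3 : MemLp (fun x => ((-(deriv u x * surfaceCurvature u x) : ℝ) : ℂ)) 2 volume := by
    refine (k2.memLp_top.top_mul hκ).neg.ae_eq (Eventually.of_forall fun x => ?_)
    simp
  have cm : ∀ {f : ℝ → ℝ} (r : ℝ), MemLp (fun x => (f x : ℂ)) 2 volume →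
      MemLp (fun x => ((r * f x : ℝ) : ℂ)) 2 volume := fun r hf =>
    (hf.const_mul (r : ℂ)).ae_eq (Eventually.of_forall fun x => by simp)
  have ad : ∀ {f f' : ℝ → ℝ}, MemLp (fun x => (f x : ℂ)) 2 volume →
      MemLp (fun x => (f' x : ℂ)) 2 volume → MemLp (fun x => ((f x + f' x : ℝ) : ℂ)) 2 volume :=
    fun hf hf' => (hf.add hf').ae_eq (Eventually.of_forall fun x => by simp)
  have eim := congrArg hilbertReal (funext (im_babenkoSymbol (g := g) (γ := γ) (σ := σ) (c := c)
    (u := u)))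
  have eτ : hilbertReal (fun x => -(deriv u x * surfaceCurvature u x))
      = absD (fun β => (1 + absD u β) / √(babenkoJ u β)) :=
    hilbertReal_congr ((deriv_tangent hu).mono fun x hx => hx.1.symm)
  have esq : absD (fun β => u β ^ 2) = hilbertReal fun x => 2 * (u x * deriv u x) := by
    rw [absD, deriv_sq hm]
  have ecu : absD (fun β => u β ^ 3) = hilbertReal fun x => 3 * (u x ^ 2 * deriv u x) := by
    rw [absD, deriv_cube hm]
  -- As H preserves real functions, Re PB = (Re B + H Im B)/2. The derivatives of u², u³ and of the
  -- tangent in Im B produce the |D| terms, and the result is the Babenko equation with the opposite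
  -- sign.
  have hre : ∀ᵐ x, (projNeg (babenkoSymbol g γ σ c u) x).re = 0 := by
    filter_upwards [im_hilbert hL,
      hilbertReal_add (cm (-(g + c * γ)) m1) (ad (cm (-(γ ^ 2 / 3)) m2) (cm (-2 * σ) m3)),
      hilbertReal_add (cm (-(γ ^ 2 / 3)) m2) (cm (-2 * σ) m3),
      hilbertReal_const_mul m1 (-(g + c * γ)), hilbertReal_const_mul m2 (-(γ ^ 2 / 3)),
      hilbertReal_const_mul m3 (-2 * σ), hu.equation, deriv_tangent hu]
      with x a1 a2 a3 a4 a5 a6 a7 a8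
    have e1 : (projNeg (babenkoSymbol g γ σ c u) x).re
        = ((babenkoSymbol g γ σ c u x).re + (hilbert (babenkoSymbol g γ σ c u) x).im) / 2 := by
      simp [projNeg]
    rw [e1, a1, eim, a2, a3, a4, a5, a6, re_babenkoSymbol, eτ, ← esq, ← ecu]
    rw [a8.2] at a7
    rw [show hilbertReal (deriv u) = absD u from rfl]
    linear_combination -a7
  have h0 := (hasNegSpectrum_projNeg hL).ae_eq_zero_of_re_eq_zero hre
  refine (hasPosSpectrum_sub_projNeg hL).congr ?_
  filter_upwards [h0] with x hx
  rw [hx]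
  simp

/-- Bernoulli's law at the free surface. -/
theorem bernoulli_law (hu : IsBabenkoSolution g γ σ c u)
    (h : IsSteadyProfile γ c u (holTrace u) (steadyQ γ c u)) :
    ∀ᵐ x, (steadyDQ γ c u x + (c + γ * u x) * (1 + holTrace (deriv u) x)) *
        (star (steadyDQ γ c u x) + (c + γ * u x) * (1 + star (holTrace (deriv u) x)))
      = (1 + holTrace (deriv u) x) * (1 + star (holTrace (deriv u) x)) *
        (c ^ 2 - 2 * g * u x + 2 * σ * surfaceCurvature u x) := by
  have hm := hu.memH2
  have hq := h.neg_dq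
  have hqt := h.top_dq
  have hR := h.neg_div
  have hRt := h.top_div
  have hne := h.ne_zero
  have hdw := h.neg_dw
  have hdwt := h.top_dw
  have hsub := h.sub_star_dq
  rw [deriv_steadyQ hm] at hq hqt hsub
  rw [deriv_holTrace hm] at hR hRt hne hdw hdwt hsub
  -- The combination built here simplifies to (1 + w')B̄ - q'².
  have n1 := (hasPosSpectrum_babenkoSymbol hu h).star
  have n2 := hq.mul hq (hqt.top_mul hq.memLp)
  have n3 := hR.mul n2 (hRt.top_mul n2.memLp)
  have n4 := (n1.sub n2).add n3
  have n5 := n4.add (hdw.mul n4 (hdwt.top_mul n4.memLp))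
  have key : ∀ x, (star (babenkoSymbol g γ σ c u x) - steadyDQ γ c u x * steadyDQ γ c u x
      + holTrace (deriv u) x / (1 + holTrace (deriv u) x) *
        (steadyDQ γ c u x * steadyDQ γ c u x)
      + holTrace (deriv u) x * (star (babenkoSymbol g γ σ c u x)
        - steadyDQ γ c u x * steadyDQ γ c u x
      + holTrace (deriv u) x / (1 + holTrace (deriv u) x) *
        (steadyDQ γ c u x * steadyDQ γ c u x)))
      = (1 + holTrace (deriv u) x) * (1 + star (holTrace (deriv u) x)) *
        (c ^ 2 - 2 * g * u x + 2 * σ * surfaceCurvature u x)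
        - (steadyDQ γ c u x + (c + γ * u x) * (1 + holTrace (deriv u) x)) *
        (star (steadyDQ γ c u x) + (c + γ * u x) * (1 + star (holTrace (deriv u) x))) := by
    intro x
    have h1 := hne x
    have h2 := hsub x
    simp only [babenkoSymbol, star_sub, star_mul', star_add, star_one, star_pow, star_star]
    simp only [Complex.star_def, Complex.conj_ofReal, map_ofNat] at h2 ⊢
    generalize conj (holTrace (deriv u) x) = W' at *
    generalize conj (steadyDQ γ c u x) = Q' at *
    have h3 : Q' = steadyDQ γ c u x + (c + γ * u x) * (holTrace (deriv u) x - W') := by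
      linear_combination -h2
    rw [h3]
    field_simp
    ring
  -- By `key` this Hardy function is the difference of the two sides of Bernoulli's law, which is
  -- real.
  have hz := n5.ae_eq_zero_of_star_eq (Eventually.of_forall fun x => by
    rw [key]
    simp only [star_sub, star_mul', star_add, star_one, star_pow, star_star]
    simp only [Complex.star_def, Complex.conj_ofReal, map_ofNat]
    ring)
  filter_upwards [hz] with x hx
  rw [key] at hx
  exact (sub_eq_zero.1 hx).symm

end Bernoulli

/-! ### Translation invariance and the travelling wave. -/

theorem deriv_translate (f : ℝ → ℂ) (s : ℝ) :
    deriv (fun x => f (x + s)) = fun x => deriv f (x + s) :=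
  funext fun x => deriv_comp_add_const (f := f) s x

theorem ae_translate {p : ℝ → Prop} (h : ∀ᵐ x, p x) (s : ℝ) : ∀ᵐ x : ℝ, p (x + s) :=
  (measurePreserving_add_right (volume : Measure ℝ) s).quasiMeasurePreserving.ae h

theorem IsH1.projNeg_eq {f f' : ℝ → ℂ} (h : IsH1 f f') (hf : HasNegSpectrum f) :
    projNeg f = f := by
  have e : _root_.hilbert f = fun x => Complex.I * f x :=
    Continuous.ae_eq_iff_eq volume h.hilbert.continuous (h.continuous.const_mul _) |>.1
      hf.hilbert_ae_eq
  funext x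
  rw [projNeg, e]
  linear_combination (-(f x) / 2) * Complex.I_mul_I

theorem IsH1.contDiff_one {f f' f'' : ℝ → ℂ} (h : IsH1 f f') (h' : IsH1 f' f'') :
    ContDiff ℝ 1 f := by
  rw [contDiff_one_iff_deriv, h.deriv_eq h'.continuous]
  exact ⟨fun x => (h.hasDerivAt h'.continuous x).differentiableAt, h'.continuous⟩

namespace IsSteadyProfile

variable {γ c : ℝ} {u : ℝ → ℝ} {w q : ℝ → ℂ}

theorem waveFUnderline_translate (h : IsSteadyProfile γ c u w q) (s : ℝ) :
    ∀ᵐ x, waveFUnderline γ (fun x => w (x + s)) (fun x => q (x + s)) x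
      = waveFUnderline γ w q (x + s) := by
  filter_upwards [projNeg_translate h.memLp_velocity_integrand s,
    projNeg_translate h.memLp_vorticity_integrand s] with x h1 h2
  simp only [waveFUnderline, waveF, waveF1, waveJ, deriv_translate] at h1 h2 ⊢
  rw [h1, h2]

theorem waveKinetic_translate (h : IsSteadyProfile γ c u w q) (s : ℝ) :
    ∀ᵐ x, waveKinetic (fun x => w (x + s)) (fun x => q (x + s)) x = waveKinetic w q (x + s) := by
  filter_upwards [projNeg_translate h.memLp_kinetic s] with x h1
  simp only [waveKinetic, waveJ, deriv_translate] at h1 ⊢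
  rw [h1]

theorem waveT1_translate (h : IsSteadyProfile γ c u w q) (s : ℝ) :
    ∀ᵐ x, waveT1 (fun x => w (x + s)) (fun x => q (x + s)) x = waveT1 w q (x + s) := by
  filter_upwards [projNeg_translate h.memLp_transport s] with x h1
  simp only [waveT1, deriv_translate] at h1 ⊢
  rw [h1]

end IsSteadyProfile

theorem waveCapillary_translate {w : ℝ → ℂ}
    (h : MemLp (fun x => (((deriv (deriv w) x /
      ((√(waveJ w x) : ℂ) * (1 + deriv w x))).im : ℝ) : ℂ)) 2 volume) (s : ℝ) :
    ∀ᵐ x, waveCapillary (fun x => w (x + s)) x = waveCapillary w (x + s) := by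
  filter_upwards [projNeg_translate h s] with x h1
  simp only [waveCapillary, waveJ, deriv_translate] at h1 ⊢
  rw [h1]

theorem deriv_travelling {w : ℝ → ℂ} (hw : Differentiable ℝ w) (c α t : ℝ) :
    deriv (fun s => w (α + c * s)) t = c * deriv w (α + c * t) := by
  have h1 : HasDerivAt (fun s : ℝ => α + c * s) c t := by
    simpa using ((hasDerivAt_id t).const_mul c).const_add α
  exact ((hw (α + c * t)).hasDerivAt.scomp t h1).deriv.trans (by simp)

theorem isWaterWaveSolution_travelling {g γ σ c : ℝ} {u : ℝ → ℝ}
    (hu : IsBabenkoSolution g γ σ c u) (hconf : IsConformalProfile u) :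
    IsWaterWaveSolution g γ σ (fun t α => holTrace u (α + c * t))
      (fun t α => steadyQ γ c u (α + c * t)) := by
  have hm := hu.memH2
  have h := hu.isSteadyProfile hconf
  obtain ⟨w1, w2⟩ := isH1_holTrace hm
  obtain ⟨q1, f, q2⟩ := isH1_steadyQ (γ := γ) (c := c) hm
  have hlin : ContDiff ℝ 1 (fun p : ℝ × ℝ => p.2 + c * p.1) := by fun_prop
  have hκm := h.memLp_surfaceCurvature hm
  have hκ : ∀ᵐ x, (deriv (deriv (holTrace u)) x /
      ((√(waveJ (holTrace u) x) : ℂ) * (1 + deriv (holTrace u) x))).im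
      = surfaceCurvature u x := by
    -- w' is only in H¹, so its classical derivative is identified with the weak one almost
    -- everywhere.
    filter_upwards [w2.ae_hasDerivAt] with x hx
    rw [surfaceCurvature]
    have e : deriv (deriv (holTrace u)) x = holTrace (deriv (deriv u)) x := by
      rw [deriv_holTrace hm, hx.deriv]
    rw [e]
  have hcap := hκm.ae_eq (hκ.mono fun x hx => by simp only [hx] : _ =ᵐ[volume] fun x =>
    (((deriv (deriv (holTrace u)) x /
      ((√(waveJ (holTrace u) x) : ℂ) * (1 + deriv (holTrace u) x))).im : ℝ) : ℂ))
  have hB := bernoulli_law hu h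
  rw [← deriv_holTrace hm, ← deriv_steadyQ hm] at hB
  refine ⟨(w1.contDiff_one w2).comp hlin, (q1.contDiff_one q2).comp hlin,
    fun t => (w1.translate _).memH2 (w2.translate _), fun t => (q1.translate _).memH2
    (q2.translate _), fun t => (w1.translate _).projNeg_eq (h.neg_w.translate _),
    fun t => (q1.translate _).projNeg_eq (h.neg_q.translate _), fun t α => ?_, fun t => ?_,
    fun t => ?_⟩
  · rw [waveJ, deriv_translate]
    exact pow_ne_zero _ (norm_ne_zero_iff.2 (h.ne_zero _))
  · filter_upwards [ae_translate h.kinematic (c * t), h.waveFUnderline_translate (c * t)]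
      with α e1 e2
    rw [e2, deriv_travelling ((w1.contDiff_one w2).differentiable one_ne_zero), deriv_translate]
    exact e1
  · filter_upwards [ae_translate (h.dynamic hκm hκ hB) (c * t),
      h.waveFUnderline_translate (c * t), h.waveKinetic_translate (c * t),
      h.waveT1_translate (c * t), waveCapillary_translate hcap (c * t)] with α e1 e2 e3 e4 e5
    rw [e2, e3, e4, e5, deriv_travelling ((q1.contDiff_one q2).differentiable one_ne_zero),
      deriv_translate]
    exact e1

end

theorem corollaryt (g γ σ c : ℝ) (u : ℝ → ℝ) (hu_ne : u ≠ 0)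
    (hu : IsBabenkoSolution g γ σ c u) (hconf : IsConformalProfile u) :
    IsSolitaryWave g γ σ c
      (fun t α => (hilbertReal u (α + c * t) : ℂ) + Complex.I * (u (α + c * t) : ℂ))
      (fun t α =>
        -(c * (hilbertReal u (α + c * t) : ℂ))
          - γ / 2 * (hilbertReal (fun β => u β ^ 2) (α + c * t) : ℂ)
          - Complex.I * (c * (u (α + c * t) : ℂ) + γ / 2 * (u (α + c * t) : ℂ) ^ 2)) := by
  have hQ : ∀ x : ℝ, -(c * (hilbertReal u x : ℂ))
      - γ / 2 * (hilbertReal (fun β => u β ^ 2) x : ℂ)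
      - Complex.I * (c * (u x : ℂ) + γ / 2 * (u x : ℂ) ^ 2) = steadyQ γ c u x := by
    intro x
    simp only [steadyQ, holTrace]
    push_cast
    ring
  simp only [hQ]
  refine ⟨isWaterWaveSolution_travelling hu hconf, holTrace u, steadyQ γ c u, ?_,
    fun _ _ => rfl, fun _ _ => rfl, (isH1_holTrace hu.memH2).1.tendsto_zero,
    (isH1_steadyQ hu.memH2).1.tendsto_zero⟩
  intro h0
  refine hu_ne (funext fun x => ?_)
  have := congrArg Complex.im (congrFun h0 x)
  simpa [holTrace] using this
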